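/- Let $k$ be an algebraically closed field. For a commutative ring $R$, an endomorphism of $\mathbb{A}^n_R$ is a tuple $f=(f_1,\dots,f_n)$ with $f_i\in R[x_1,\dots,x_n]$, composed as maps; its degree is $\deg f=\max_i\deg f_i$; $\mathrm{Aut}(\mathbb{A}^n_R)$ is the group of invertible endomorphisms and $\mathrm{SAut}(\mathbb{A}^n_R)$ is its subgroup of elements with Jacobian determinant $1$. An element $F=(F_1,\dots,F_n)\in\mathrm{SAut}(\mathbb{A}^n_{k((t))})$ has a value at $t=0$ if all coefficients of the $F_i$ lie in $k[[t]]$; its value $F(0)$ is then obtained by replacing $t$ with $0$. An algebraic variety over $k$ is a reduced separated scheme of finite type over $k$, whose points are its closed points. A morphism from an algebraic variety $A$ to $\mathrm{Aut}(\mathbb{A}^n_k)$ (respectively $\mathrm{SAut}(\mathbb{A}^n_k)$) is an element of $\mathrm{Aut}(\mathbb{A}^n_{k[A]})$ (respectively $\mathrm{SAut}(\mathbb{A}^n_{k[A]})$), where $k[A]$ is the ring of regular functions on $A$; by evaluation it gives a map from $A$ to the group. A subset of $\mathrm{Aut}(\mathbb{A}^n_k)$ is closed if its preimage under every morphism from every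 algebraic variety is closed, and $\mathrm{SAut}(\mathbb{A}^n_k)$ has the induced topology. Let $f\in\mathrm{SAut}(\mathbb{A}^n_k)$ be dynamically regular: $\deg f\ge 2$ and the indeterminacy loci of the extensions of $f$ and $f^{-1}$ to rational maps of $\mathbb{P}^n_k$ are disjoint. Then the following hold. 1. If $\alpha\in\mathrm{SAut}(\mathbb{A}^n_{k((t))})$ is such that $\alpha f\alpha^{-1}$ has a value at $t=0$, then $\alpha$ has a value at $t=0$, this value $\alpha(0)$ belongs to $\mathrm{SAut}(\mathbb{A}^n_k)$, and the value of $\alpha f\alpha^{-1}$ at $t=0$ is $\alpha(0)\,f\,\alpha(0)^{-1}$. 2. For each integer $d\ge 0$, the set $\{gfg^{-1}\mid g\in\mathrm{SAut}(\mathbb{A}^n_k),\ \deg g\le d\}$ is closed in $\mathrm{SAut}(\mathbb{A}^n_k)$. 3. If $n=2$, the conjugacy class of $f$ in $\mathrm{SAut}(\mathbb{A}^n_k)$ is closed in $\mathrm{SAut}(\mathbb{A}^n_k)$. 4. If $k$ is uncountable, then for each algebraic variety $A$, each morphism $A\to\mathrm{SAut}(\mathbb{A}^n_k)$ and each locally closed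 subset $B\subset A$ contained in the preimage of the conjugacy class of $f$ in $\mathrm{SAut}(\mathbb{A}^n_k)$, the closure of $B$ in $A$ is also contained in this preimage. -/

import Mathlib

universe u

noncomputable section

namespace PolyAut

open MvPolynomial

/-! ### Polynomial endomorphisms and automorphisms of affine space -/

/-- `End(𝔸ⁿ_R)`: an endomorphism `(f₁, …, fₙ)` of affine `n`-space over `R`, given by its
coordinates `fᵢ ∈ R[x₁, …, xₙ]`. -/
@[ext]
structure PolyEnd (n : ℕ) (R : Type u) [CommRing R] where
  coord : Fin n → MvPolynomial (Fin n) R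

namespace PolyEnd

variable {n : ℕ} {R S : Type u} [CommRing R] [CommRing S]

/-- Composition of maps: `(f * g)(x) = f (g x)`, i.e. `(f * g)ᵢ = fᵢ(g₁, …, gₙ)`. -/
instance instMul : Mul (PolyEnd n R) := ⟨fun f g => ⟨fun i => bind₁ g.coord (f.coord i)⟩⟩

/-- The identity map `(x₁, …, xₙ)`. -/
instance instOne : One (PolyEnd n R) := ⟨⟨X⟩⟩

theorem mul_coord (f g : PolyEnd n R) (i : Fin n) :
    (f * g).coord i = bind₁ g.coord (f.coord i) := rfl

theorem one_coord (i : Fin n) : (1 : PolyEnd n R).coord i = X i := rfl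

instance instMonoid : Monoid (PolyEnd n R) where
  mul_assoc f g h := PolyEnd.ext <| funext fun i => by
    rw [mul_coord, mul_coord, mul_coord, bind₁_bind₁]
    rfl
  one_mul f := PolyEnd.ext <| funext fun i => by rw [mul_coord, one_coord, bind₁_X_right]
  mul_one f := PolyEnd.ext <| funext fun i => by
    rw [mul_coord, show (1 : PolyEnd n R).coord = X from rfl, bind₁_X_left, AlgHom.id_apply]

/-- The degree of `(f₁, …, fₙ)`: the maximum of the degrees of the `fᵢ`. -/
def degree (f : PolyEnd n R) : ℕ := Finset.univ.sup fun i => (f.coord i).totalDegree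

/-- The Jacobian `det (∂fᵢ/∂xⱼ)`. -/
def jac (f : PolyEnd n R) : MvPolynomial (Fin n) R :=
  (Matrix.of fun i j => pderiv j (f.coord i)).det

/-- Change of coefficients along a ring homomorphism. -/
def map (φ : R →+* S) : PolyEnd n R →* PolyEnd n S where
  toFun f := ⟨fun i => MvPolynomial.map φ (f.coord i)⟩
  map_one' := PolyEnd.ext <| funext fun i => MvPolynomial.map_X φ i
  map_mul' f g := PolyEnd.ext <| funext fun i => map_bind₁ φ g.coord (f.coord i)

theorem map_coord (φ : R →+* S) (f : PolyEnd n R) (i : Fin n) :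
    (map φ f).coord i = MvPolynomial.map φ (f.coord i) := rfl

theorem jac_one : (1 : PolyEnd n R).jac = 1 := by
  have h : (Matrix.of fun i j => pderiv j ((1 : PolyEnd n R).coord i)) =
      (1 : Matrix (Fin n) (Fin n) (MvPolynomial (Fin n) R)) := by
    ext1 i j
    simp only [Matrix.of_apply, one_coord, pderiv_X, Matrix.one_apply, Pi.single_apply]
  rw [jac, h, Matrix.det_one]

theorem pderiv_bind₁ (g : Fin n → MvPolynomial (Fin n) R) (j : Fin n)
    (p : MvPolynomial (Fin n) R) :
    pderiv j (bind₁ g p) = ∑ l, bind₁ g (pderiv l p) * pderiv j (g l) := by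
  induction p using MvPolynomial.induction_on with
  | C a => simp
  | add p q hp hq => simp [hp, hq, add_mul, Finset.sum_add_distrib]
  | mul_X p i hp =>
    simp only [map_mul, bind₁_X_right, Derivation.leibniz, hp, smul_eq_mul, pderiv_X, map_add,
      add_mul, Finset.sum_add_distrib, Finset.mul_sum]
    congr 1
    · rw [Finset.sum_eq_single i]
      · simp
      · intro b _ hb
        simp [hb.symm]
      · simp
    · exact Finset.sum_congr rfl fun l _ => by ring

theorem jac_mul (f g : PolyEnd n R) : (f * g).jac = bind₁ g.coord f.jac * g.jac := by
  rw [jac, jac, jac, AlgHom.map_det, ← Matrix.det_mul]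
  congr 1
  ext1 i j
  simp only [Matrix.of_apply, mul_coord, pderiv_bind₁, Matrix.mul_apply, AlgHom.mapMatrix_apply,
    Matrix.map_apply]

theorem jac_map (φ : R →+* S) (f : PolyEnd n R) :
    (map φ f).jac = MvPolynomial.map φ f.jac := by
  rw [jac, jac, RingHom.map_det]
  congr 1
  ext1 i j
  simp only [Matrix.of_apply, map_coord, pderiv_map, RingHom.mapMatrix_apply, Matrix.map_apply]

end PolyEnd

/-- `Aut(𝔸ⁿ_R)`: the group of polynomial endomorphisms having a polynomial inverse. -/
abbrev PAut (n : ℕ) (R : Type u) [CommRing R] : Type u := (PolyEnd n R)ˣ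

/-- `SAut(𝔸ⁿ_R)`: the group of automorphisms of Jacobian `1`. -/
def SAut (n : ℕ) (R : Type u) [CommRing R] : Subgroup (PAut n R) where
  carrier := {f | (f : PolyEnd n R).jac = 1}
  one_mem' := PolyEnd.jac_one
  mul_mem' {f g} hf hg := by
    simp only [Set.mem_ofPred_eq] at hf hg ⊢
    rw [Units.val_mul, PolyEnd.jac_mul, hf, hg, map_one, one_mul]
  inv_mem' {f} hf := by
    simp only [Set.mem_ofPred_eq] at hf ⊢
    have h := PolyEnd.jac_mul (f : PolyEnd n R) (↑f⁻¹ : PolyEnd n R)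
    rw [Units.mul_inv, PolyEnd.jac_one, hf, map_one, one_mul] at h
    exact h.symm

namespace SAut

variable {n : ℕ} {R S : Type u} [CommRing R] [CommRing S]

/-- The underlying endomorphism of an element of `SAut(𝔸ⁿ_R)`. -/
abbrev toEnd (f : SAut n R) : PolyEnd n R := ((f : PAut n R) : PolyEnd n R)

/-- Change of coefficients `SAut(𝔸ⁿ_R) → SAut(𝔸ⁿ_S)` along a ring homomorphism. -/
def map (φ : R →+* S) : SAut n R →* SAut n S :=
  ((Units.map (PolyEnd.map φ)).comp (SAut n R).subtype).codRestrict (SAut n S) fun f => by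
    show (PolyEnd.map φ (toEnd f)).jac = 1
    rw [PolyEnd.jac_map, show (toEnd f).jac = 1 from f.2, map_one]

end SAut

/-! ### Indeterminacy loci in projective space -/

section Indeterminacy

variable {n : ℕ} {k : Type u} [Field k]

/-- The homogeneous polynomials `h₀, …, hₙ` of the same degree `m`, not all zero, represent the
extension to `ℙⁿ` of the endomorphism `f` of `𝔸ⁿ`, where `𝔸ⁿ` is embedded in `ℙⁿ` by
`(x₁, …, xₙ) ↦ [1 : x₁ : ⋯ : xₙ]`: on `𝔸ⁿ` the map `[h₀ : ⋯ : hₙ]` is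
`[1 : f₁ : ⋯ : fₙ]`. -/
def Represents (f : PolyEnd n k) (m : ℕ) (h : Fin (n + 1) → MvPolynomial (Fin (n + 1)) k) :
    Prop :=
  (∀ i, (h i).IsHomogeneous m) ∧ h ≠ 0 ∧
    ∀ i : Fin n, aeval (Fin.cons 1 X : Fin (n + 1) → MvPolynomial (Fin n) k) (h i.succ) =
      f.coord i * aeval (Fin.cons 1 X : Fin (n + 1) → MvPolynomial (Fin n) k) (h 0)

/-- The indeterminacy locus in `ℙⁿ` of the extension of `f` to a rational map `ℙⁿ ⇢ ℙⁿ`: the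
points at which every representative of the rational map vanishes. -/
def indeterminacy (f : PolyEnd n k) : Set (Projectivization k (Fin (n + 1) → k)) :=
  {p | ∀ m h, Represents f m h → ∀ i, eval p.rep (h i) = 0}

/-- `f` is dynamically regular: it has degree at least `2`, and the indeterminacy loci of the
extensions of `f` and `f⁻¹` to `ℙⁿ` are disjoint. -/
def IsDynamicallyRegular (f : PAut n k) : Prop :=
  2 ≤ (f : PolyEnd n k).degree ∧
    Disjoint (indeterminacy (f : PolyEnd n k)) (indeterminacy (↑f⁻¹ : PolyEnd n k))

end Indeterminacy

/-! ### Values at `t = 0` of automorphisms over `k((t))` -/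

section Value

variable {n : ℕ} {k : Type u} [Field k]

/-- `F` has a value (has no pole) at `t = 0`: no negative power of `t` occurs in any
coefficient of any coordinate of `F`. -/
def HasValue (F : PolyEnd n (LaurentSeries k)) : Prop :=
  ∀ (i : Fin n) (m : Fin n →₀ ℕ) (j : ℤ), j < 0 →
    HahnSeries.coeff (MvPolynomial.coeff m (F.coord i)) j = 0

/-- The value `F(0)`, obtained by taking the coefficient of `t⁰` in each coefficient of `F`
(meaningful only if `HasValue F`). -/
def value (F : PolyEnd n (LaurentSeries k)) : PolyEnd n k :=
  ⟨fun i => ∑ m ∈ (F.coord i).support,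
    monomial m (HahnSeries.coeff (MvPolynomial.coeff m (F.coord i)) 0)⟩

/-- The inclusion `SAut(𝔸ⁿ_k) ⊆ SAut(𝔸ⁿ_{k((t))})`. -/
def toLaurent : SAut n k →* SAut n (LaurentSeries k) := SAut.map HahnSeries.C

end Value

/-! ### Algebraic varieties, morphisms to `Aut(𝔸ⁿ)`, and the Zariski topology -/

open AlgebraicGeometry CategoryTheory

/-- An algebraic variety over `k`: a reduced separated scheme of finite type over `k`
(not necessarily irreducible). -/
structure Variety (k : Type u) [Field k] where
  X : Scheme.{u}
  str : X ⟶ Spec (CommRingCat.of k)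
  isReduced : IsReduced X
  isSeparated : IsSeparated str
  locallyOfFiniteType : LocallyOfFiniteType str
  quasiCompact : QuasiCompact str

namespace Variety

variable {k : Type u} [Field k]

/-- The `k`-points of `A`; for `k` algebraically closed these are the closed points of `A`. -/
structure Point (A : Variety k) where
  hom : Spec (CommRingCat.of k) ⟶ A.X
  hom_str : hom ≫ A.str = 𝟙 _

/-- The point of the underlying topological space of `A` given by a `k`-point. -/
def Point.toPt {A : Variety k} (x : A.Point) : A.X := x.hom (IsLocalRing.closedPoint k)

/-- The Zariski topology on the `k`-points of `A`. -/
instance (A : Variety k) : TopologicalSpace A.Point :=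
  TopologicalSpace.induced Point.toPt inferInstance

/-- The ring `k[A]` of regular functions on `A`. -/
abbrev functions (A : Variety k) : Type u := Γ(A.X, ⊤)

/-- The value of regular functions at a `k`-point. -/
def Point.ev {A : Variety k} (x : A.Point) : A.functions →+* k :=
  (Scheme.ΓSpecIso (CommRingCat.of k)).hom.hom.comp x.hom.appTop.hom

end Variety

variable {n : ℕ} {k : Type u} [Field k]

/-- The map `A → Aut(𝔸ⁿ_k)` given by a morphism, i.e. by an `A`-automorphism `F` of
`A × 𝔸ⁿ`, which is an element of `Aut(𝔸ⁿ_{k[A]})`. -/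
def PAut.fiber {A : Variety k} (F : PAut n A.functions) (x : A.Point) : PAut n k :=
  Units.map (PolyEnd.map x.ev) F

/-- The map `A → SAut(𝔸ⁿ_k)` given by a morphism, i.e. by an element of
`SAut(𝔸ⁿ_{k[A]})`. -/
def SAut.fiber {A : Variety k} (F : SAut n A.functions) (x : A.Point) : SAut n k :=
  SAut.map x.ev F

/-- The Zariski topology on `Aut(𝔸ⁿ_k)`: a subset is closed if and only if its preimage under
every morphism from an algebraic variety is closed. As a subset of `Aut(𝔸ⁿ_k)`, the group
`SAut(𝔸ⁿ_k)` carries the subspace topology. -/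
instance zariskiTopology : TopologicalSpace (PAut n k) :=
  TopologicalSpace.ofClosed
    {T | ∀ (A : Variety k) (F : PAut n A.functions), IsClosed (PAut.fiber F ⁻¹' T)}
    (fun A F => by simp)
    (fun U hU A F => by
      rw [Set.preimage_sInter]
      exact isClosed_biInter fun T hT => hU hT A F)
    (fun S hS T hT A F => by
      rw [Set.preimage_union]
      exact (hS A F).union (hT A F))

/-- The conjugacy class `{g f g⁻¹ | g ∈ SAut(𝔸ⁿ_k)}` of `f` in `SAut(𝔸ⁿ_k)`. -/
def SAut.conjClass (f : SAut n k) : Set (SAut n k) :=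
  {h | ∃ g : SAut n k, h = g * f * g⁻¹}

end PolyAut

end

open PolyAut

open PolyAut

/-! Everything rests on one valuative fact, `IsDynamicallyRegular.exists_map_eq`: for a valuation
ring O over k with fraction field L, if h = a f a⁻¹ has coefficients in O, so does a. Suppose a⁻¹
has a pole and scale it to b = c a⁻¹, with c in the maximal ideal and b integral of nonzero
reduction b̄. Clearing denominators in f ∘ a⁻¹ = a⁻¹ ∘ h shows that the homogenization of f at (c,
b) is c^(d-1) (b ∘ h), where d = deg f ≥ 2; modulo the maximal ideal, the top form of f vanishes at
b̄. The same holds for f⁻¹. A common nonzero zero of the two top forms would be a common point of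
indeterminacy at infinity, so b̄ = 0, a contradiction. Finally a inherits integrality from a⁻¹
because a map of Jacobian 1 is dominant, in every characteristic (`SAut.definedOver_inv`).

Statement 1 is the case O = k[[t]]. For statement 2, conjugators of bounded degree over a dense set
Z of points form one automorphism over the ring of all functions Z → k, since inverses have bounded
degree too. A suitable prime of this ring and a dominating valuation ring turn the limit point into
a specialization; the valuative fact gives a conjugator over the residue field, and the
Nullstellensatz brings it down to k.

Statement 3 reduces to statement 2: in the plane, every conjugate of f has a conjugator of degree at
most its own degree plus 1 (`IsDynamicallyRegular.exists_conj_degree_le`). One minimizes deg(f^m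
g⁻¹) over m and uses that a nonaffine plane automorphism contracts the line at infinity to a point.
Statement 4 writes the preimage of the class as a countable union of closed sets; over an
uncountable field, a locally closed set covered by such a union cannot have closure points outside
it. -/

namespace PolyAut
open MvPolynomial

/-! ### Homogenization, and leading terms under scaling -/

section Homogenization

variable {σ : Type*} {R S T : Type*} [CommRing R] [CommRing S] [CommRing T]

theorem eval₂_mul_of_isHomogeneous (φ : R →+* S) (c : S) (b : σ → S) {p : MvPolynomial σ R}
    {m : ℕ} (hp : p.IsHomogeneous m) :
    eval₂ φ (fun i => c * b i) p = c ^ m * eval₂ φ b p := by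
  rw [eval₂_eq, eval₂_eq, Finset.mul_sum]
  refine Finset.sum_congr rfl fun d hd => ?_
  have : ∏ i ∈ d.support, c ^ d i = c ^ m := by
    rw [Finset.prod_pow_eq_pow_sum, ← hp.degree_eq_sum_deg_support hd]
  simp only [mul_pow, Finset.prod_mul_distrib, this]
  ring

theorem sum_homogeneousComponent_of_totalDegree_le {p : MvPolynomial σ R} {d : ℕ}
    (hp : p.totalDegree ≤ d) : ∑ j ∈ Finset.range (d + 1), homogeneousComponent j p = p := by
  conv_rhs => rw [← sum_homogeneousComponent p]
  refine (Finset.sum_subset (Finset.range_mono (by omega)) fun j _ hj => ?_).symm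
  exact homogeneousComponent_eq_zero _ _ (by simpa using hj)

/-- The value at `(c, b)` of the homogenization of `p` in degree `d`. -/
noncomputable def homogVal (φ : R →+* S) (d : ℕ) (p : MvPolynomial σ R) (c : S) (b : σ → S) : S :=
  ∑ j ∈ Finset.range (d + 1), c ^ (d - j) * eval₂ φ b (homogeneousComponent j p)

theorem homogVal_mul (φ : R →+* S) {d : ℕ} {p : MvPolynomial σ R} (hp : p.totalDegree ≤ d)
    (c : S) (b : σ → S) :
    homogVal φ d p c (fun i => c * b i) = c ^ d * eval₂ φ b p := by
  conv_rhs => rw [← sum_homogeneousComponent_of_totalDegree_le hp]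
  rw [homogVal, eval₂_sum, Finset.mul_sum]
  refine Finset.sum_congr rfl fun j hj => ?_
  rw [eval₂_mul_of_isHomogeneous φ c b (homogeneousComponent_isHomogeneous j p), ← mul_assoc,
    ← pow_add, Nat.sub_add_cancel (by simpa [Nat.lt_succ_iff] using hj)]

theorem map_homogVal (φ : R →+* S) (ψ : S →+* T) (d : ℕ) (p : MvPolynomial σ R) (c : S)
    (b : σ → S) :
    ψ (homogVal φ d p c b) = homogVal (ψ.comp φ) d p (ψ c) (fun i => ψ (b i)) := by
  simp only [homogVal, map_sum, map_mul, map_pow]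
  exact Finset.sum_congr rfl fun j _ => by rw [eval₂_comp_left ψ]; rfl

/-- On the hyperplane at infinity only the top form survives. -/
theorem homogVal_zero (φ : R →+* S) (d : ℕ) (p : MvPolynomial σ R) (b : σ → S) :
    homogVal φ d p 0 b = eval₂ φ b (homogeneousComponent d p) := by
  rw [homogVal, Finset.sum_range_succ, Finset.sum_eq_zero]
  · simp
  · intro j hj
    rw [zero_pow (by simp at hj; omega), zero_mul]

/-- The form of degree j contributes c^j, so dividing by c^m and setting c = 0 isolates the lowest
form. -/
theorem exists_eval₂_mul_eq (φ : R →+* S) (c : S) (b : σ → S) {p : MvPolynomial σ R} {m : ℕ}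
    (hp : ∀ d : σ →₀ ℕ, d.degree < m → coeff d p = 0) :
    ∃ r, eval₂ φ (fun i => c * b i) p =
      c ^ m * (eval₂ φ b (homogeneousComponent m p) + c * r) := by
  set N := p.totalDegree + m
  refine ⟨∑ j ∈ Finset.Ico (m + 1) (N + 1),
    c ^ (j - (m + 1)) * eval₂ φ b (homogeneousComponent j p), ?_⟩
  conv_lhs => rw [← sum_homogeneousComponent_of_totalDegree_le (show p.totalDegree ≤ N by omega)]
  rw [eval₂_sum, Finset.range_eq_Ico, ← Finset.sum_Ico_consecutive _ (Nat.zero_le (m + 1))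
    (show m + 1 ≤ N + 1 by omega), ← Finset.range_eq_Ico, Finset.sum_range_succ,
    Finset.sum_eq_zero, zero_add, mul_add]
  · congr 1
    · exact eval₂_mul_of_isHomogeneous φ c b (homogeneousComponent_isHomogeneous m p)
    · rw [Finset.mul_sum, Finset.mul_sum]
      refine Finset.sum_congr rfl fun j hj => ?_
      rw [eval₂_mul_of_isHomogeneous φ c b (homogeneousComponent_isHomogeneous j p),
        ← mul_assoc, ← mul_assoc, ← pow_succ, ← pow_add]
      congr 2
      simp only [Finset.mem_Ico] at hj
      omega
  · intro j hj
    rw [homogeneousComponent_eq_zero', eval₂_zero]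
    rintro d hd rfl
    exact mem_support_iff.1 hd (hp d (by simpa using hj))

end Homogenization

/-! ### Linear parts, and dominance of maps of Jacobian 1 -/

section Linear

variable {n : ℕ} {R : Type*} [CommRing R]

theorem homogeneousComponent_one_eq (p : MvPolynomial (Fin n) R) :
    homogeneousComponent 1 p = ∑ j, C (coeff (Finsupp.single j 1) p) * X j := by
  classical
  ext m
  rw [coeff_homogeneousComponent, coeff_sum]
  simp only [coeff_C_mul, coeff_X, mul_ite, mul_one, mul_zero]
  split_ifs with h
  · obtain ⟨j, rfl⟩ := (Finsupp.sum_eq_one_iff m).1 h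
    rw [Finset.sum_eq_single j] <;> simp
    intro b hb h
    exact absurd (Finsupp.single_left_injective one_ne_zero h) hb
  · rw [Finset.sum_eq_zero]
    intro j _
    rw [if_neg]
    rintro rfl
    simp at h

theorem constantCoeff_pderiv (j : Fin n) (p : MvPolynomial (Fin n) R) :
    constantCoeff (pderiv j p) = coeff (Finsupp.single j 1) p := by
  classical
  induction p using MvPolynomial.induction_on with
  | C a => simp [coeff_C, Finsupp.single_eq_zero, eq_comm]
  | add p q hp hq => simp [hp, hq]
  | mul_X p i hp =>
    rw [Derivation.leibniz]
    simp only [smul_eq_mul, map_add, map_mul, constantCoeff_X, zero_mul, pderiv_X, coeff_mul_X',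
      add_zero]
    by_cases h : j = i
    · subst h; simp [constantCoeff_eq]
    · simp [Ne.symm h]

end Linear

noncomputable section

namespace PolyEnd

variable {n : ℕ} {R : Type u} [CommRing R]

/-- The matrix of the linear part of `a` at the origin. -/
def linMatrix (a : PolyEnd n R) : Matrix (Fin n) (Fin n) R :=
  Matrix.of fun i j => coeff (Finsupp.single j 1) (a.coord i)

theorem det_linMatrix (a : PolyEnd n R) : a.linMatrix.det = constantCoeff a.jac := by
  rw [jac, RingHom.map_det]
  congr 1
  ext i j
  simp [linMatrix, constantCoeff_pderiv]

theorem homogeneousComponent_one_coord (a : PolyEnd n R) (i : Fin n) :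
    homogeneousComponent 1 (a.coord i) = ∑ j, C (a.linMatrix i j) * X j :=
  homogeneousComponent_one_eq _

theorem bind₁_inv_linear {A : Matrix (Fin n) (Fin n) R} (hA : A.det = 1) (i : Fin n) :
    ∑ j, C (A⁻¹ i j) * (∑ l, C (A j l) * X l) = (X i : MvPolynomial (Fin n) R) := by
  have h : A⁻¹ * A = 1 := Matrix.nonsing_inv_mul A (by rw [hA]; exact isUnit_one)
  simp only [Finset.mul_sum, ← mul_assoc, ← C_mul]
  rw [Finset.sum_comm]
  simp only [← Finset.sum_mul, ← map_sum, ← Matrix.mul_apply, h, Matrix.one_apply]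
  simp [ite_mul]

theorem bind₁_linear_inv {A : Matrix (Fin n) (Fin n) R} (hA : A.det = 1) (i : Fin n) :
    ∑ j, C (A i j) * (∑ l, C (A⁻¹ j l) * X l) = (X i : MvPolynomial (Fin n) R) := by
  have h : A * A⁻¹ = 1 := Matrix.mul_nonsing_inv A (by rw [hA]; exact isUnit_one)
  simp only [Finset.mul_sum, ← mul_assoc, ← C_mul]
  rw [Finset.sum_comm]
  simp only [← Finset.sum_mul, ← map_sum, ← Matrix.mul_apply, h, Matrix.one_apply]
  simp [ite_mul]

theorem coord_totalDegree_le (a : PolyEnd n R) (i : Fin n) :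
    (a.coord i).totalDegree ≤ a.degree :=
  Finset.le_sup (f := fun i => (a.coord i).totalDegree) (Finset.mem_univ i)

theorem degree_le_iff {a : PolyEnd n R} {d : ℕ} :
    a.degree ≤ d ↔ ∀ i, (a.coord i).totalDegree ≤ d := by
  simp [degree, Finset.sup_le_iff]

/-- Scale the variables by a new variable T. The lowest-order term in T of p ∘ a is the lowest form
of p composed with the linear part of a, which is invertible because its determinant is the Jacobian
at the origin. So a nonzero p has nonzero p ∘ a. -/
theorem eq_zero_of_bind₁_eq_zero [IsDomain R] {a : PolyEnd n R} (ha : a.jac = 1)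
    (h0 : ∀ i, constantCoeff (a.coord i) = 0) {p : MvPolynomial (Fin n) R}
    (hp : bind₁ a.coord p = 0) : p = 0 := by
  by_contra hne
  obtain ⟨d₀, hd₀, hmin⟩ := Finset.exists_min_image p.support Finsupp.degree
    (Finset.nonempty_iff_ne_empty.2 (by simpa using hne))
  set m := d₀.degree
  set A := a.linMatrix
  have hA : A.det = 1 := by rw [det_linMatrix, ha, map_one]
  set lin : Fin n → MvPolynomial (Fin n) R := fun i => ∑ j, C (A i j) * X j
  let φ : R →+* Polynomial (MvPolynomial (Fin n) R) := Polynomial.C.comp C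
  have hC : ∀ q : MvPolynomial (Fin n) R, eval₂ φ (fun i => Polynomial.C (X i)) q =
      Polynomial.C q := fun q => by
    conv_rhs => rw [← eval₂_eta q, eval₂_comp_left Polynomial.C]
    rfl
  have h1 : ∀ i, ∃ r, eval₂ φ (fun i => Polynomial.X * Polynomial.C (X i)) (a.coord i) =
      Polynomial.X * (Polynomial.C (lin i) + Polynomial.X * r) := fun i => by
    obtain ⟨r, hr⟩ := exists_eval₂_mul_eq φ Polynomial.X (fun i => Polynomial.C (X i))
      (p := a.coord i) (m := 1) (fun d hd => by
        rw [Nat.lt_one_iff, Finsupp.degree_eq_zero_iff] at hd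
        rw [hd, ← constantCoeff_eq, h0])
    exact ⟨r, by rw [hr, hC, pow_one, homogeneousComponent_one_coord]⟩
  choose r hr using h1
  obtain ⟨r', hr'⟩ := exists_eval₂_mul_eq φ Polynomial.X
    (fun i => Polynomial.C (lin i) + Polynomial.X * r i) (p := p) (m := m) (fun d hd => by
      by_contra h
      exact absurd (hmin d (mem_support_iff.2 h)) (by omega))
  have h2 : eval₂ φ (fun i => Polynomial.X * (Polynomial.C (lin i) + Polynomial.X * r i)) p = 0 := by
    simp_rw [← hr]
    have := eval₂Hom_bind₁ φ (fun i => Polynomial.X * Polynomial.C (X i)) a.coord p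
    rw [hp, map_zero] at this
    exact this.symm
  rw [h2] at hr'
  have h3 := (mul_eq_zero.1 hr'.symm).resolve_left (pow_ne_zero _ Polynomial.X_ne_zero)
  have h4 := congrArg (Polynomial.evalRingHom 0) h3
  rw [map_add, eval₂_comp_left (Polynomial.evalRingHom 0)] at h4
  have h5 : bind₁ lin (homogeneousComponent m p) = 0 := by
    rw [← aeval_eq_bind₁, aeval_def]
    convert! h4 using 1
    simp only [map_mul, Polynomial.coe_evalRingHom, Polynomial.eval_X, zero_mul, add_zero]
    congr 1
    · ext; simp [φ]
    · funext i
      simp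
    · simp
  have h6 : homogeneousComponent m p = 0 := by
    have := congrArg (bind₁ fun i => ∑ l, C (A⁻¹ i l) * X l) h5
    rw [bind₁_bind₁, map_zero] at this
    rw [← this]
    conv_lhs => rw [← AlgHom.id_apply (R := R) (homogeneousComponent m p), ← bind₁_X_left]
    congr 2
    funext i
    simp [lin, bind₁_linear_inv hA]
  have h7 := congrArg (coeff d₀) h6
  rw [coeff_homogeneousComponent, if_pos rfl, coeff_zero] at h7
  exact mem_support_iff.1 hd₀ h7

/-- An endomorphism of Jacobian `1` is dominant. -/
theorem bind₁_injective_of_jac_eq_one [IsDomain R] {a : PolyEnd n R} (ha : a.jac = 1) :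
    Function.Injective (bind₁ a.coord) := by
  rw [injective_iff_map_eq_zero]
  intro p hp
  -- Translate the target so that the origin is fixed, which does not change the Jacobian; the
  -- translation of p is undone at the end.
  set c : Fin n → R := fun i => constantCoeff (a.coord i)
  let a' : PolyEnd n R := ⟨fun i => a.coord i - C (c i)⟩
  have ha' : a'.jac = 1 := by
    rw [← ha, jac, jac]
    congr 1
    ext1 i j
    simp [a']
  have h1 := eq_zero_of_bind₁_eq_zero (p := bind₁ (fun i => X i + C (c i)) p) ha'
    (fun i => by simp [a', c]) (by
      rw [bind₁_bind₁, ← hp]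
      congr 2
      funext i
      simp [a'])
  have h2 := congrArg (bind₁ fun i => X i - C (c i)) h1
  rw [bind₁_bind₁, map_zero] at h2
  rw [← h2]
  conv_lhs => rw [← AlgHom.id_apply (R := R) p, ← bind₁_X_left]
  congr 2
  funext i
  simp

theorem coord_eq_of_degree_le_one {a : PolyEnd n R} (ha : a.degree ≤ 1) (i : Fin n) :
    a.coord i = C (constantCoeff (a.coord i)) + ∑ j, C (a.linMatrix i j) * X j := by
  conv_lhs => rw [← sum_homogeneousComponent_of_totalDegree_le
    ((a.coord_totalDegree_le i).trans ha)]
  rw [Finset.sum_range_succ, Finset.sum_range_one, homogeneousComponent_one_coord,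
    homogeneousComponent_zero, constantCoeff_eq]

end PolyEnd

namespace SAut

variable {n : ℕ} {R S : Type u} [CommRing R] [CommRing S]

theorem jac_toEnd (a : SAut n R) : (toEnd a).jac = 1 := a.2

theorem toEnd_mul (a b : SAut n R) : toEnd (a * b) = toEnd a * toEnd b := rfl

theorem toEnd_map (φ : R →+* S) (a : SAut n R) :
    toEnd (SAut.map φ a) = PolyEnd.map φ (toEnd a) := rfl

theorem toEnd_injective : Function.Injective (toEnd : SAut n R → PolyEnd n R) :=
  fun _ _ h => Subtype.ext (Units.ext h)

theorem toEnd_inv_mul (a : SAut n R) : toEnd a⁻¹ * toEnd a = 1 := by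
  rw [← toEnd_mul, inv_mul_cancel]; rfl

theorem toEnd_mul_inv (a : SAut n R) : toEnd a * toEnd a⁻¹ = 1 := by
  rw [← toEnd_mul, mul_inv_cancel]; rfl

theorem degree_inv_le_one {a : SAut n R} (ha : (toEnd a).degree ≤ 1) :
    (toEnd a⁻¹).degree ≤ 1 := by
  set A := (toEnd a).linMatrix
  have hA : A.det = 1 := by rw [PolyEnd.det_linMatrix, jac_toEnd, map_one]
  let l : PolyEnd n R :=
    ⟨fun i => ∑ j, C (A⁻¹ i j) * (X j - C (constantCoeff ((toEnd a).coord j)))⟩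
  have hl : l * toEnd a = 1 := by
    ext1
    funext i
    rw [PolyEnd.mul_coord, PolyEnd.one_coord, ← PolyEnd.bind₁_inv_linear hA i]
    simp only [l, map_sum, map_mul, map_sub, algHom_C, bind₁_X_right]
    refine Finset.sum_congr rfl fun j _ => ?_
    conv_lhs => rw [PolyEnd.coord_eq_of_degree_le_one ha j]
    simp [A]
  have : toEnd a⁻¹ = l := by
    rw [← one_mul (toEnd a⁻¹), ← hl, mul_assoc, toEnd_mul_inv, mul_one]
  rw [this, PolyEnd.degree_le_iff]
  intro i
  refine totalDegree_finsetSum_le fun j _ => (totalDegree_mul _ _).trans ?_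
  rw [totalDegree_C, zero_add]
  refine (totalDegree_sub _ _).trans ?_
  rw [totalDegree_C, max_le_iff]
  exact ⟨(isHomogeneous_X R j).totalDegree_le, Nat.zero_le _⟩

end SAut

/-! ### Descending coefficients along a ring homomorphism -/

section Lift

variable {n : ℕ} {R S : Type u} [CommRing R] [CommRing S]

/-- All coefficients of `a` lie in the image of `φ`. -/
def PolyEnd.DefinedOver (φ : R →+* S) (a : PolyEnd n S) : Prop :=
  ∀ i m, coeff m (a.coord i) ∈ φ.range

theorem PolyEnd.exists_map_eq {φ : R →+* S} {a : PolyEnd n S} (h : a.DefinedOver φ) :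
    ∃ b : PolyEnd n R, PolyEnd.map φ b = a := by
  have : ∀ i, ∃ q, MvPolynomial.map φ q = a.coord i := fun i => by
    have := (mem_range_map_iff_coeffs_subset (f := φ) (x := a.coord i)).2 (by
      intro c hc
      obtain ⟨m, -, rfl⟩ := mem_coeffs_iff.1 hc
      exact h i m)
    exact this
  choose q hq using this
  exact ⟨⟨q⟩, PolyEnd.ext (funext hq)⟩

theorem PolyEnd.definedOver_map (φ : R →+* S) (b : PolyEnd n R) :
    (PolyEnd.map φ b).DefinedOver φ := fun i m => by
  rw [PolyEnd.map_coord, coeff_map]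
  exact ⟨_, rfl⟩

theorem PolyEnd.map_injective {φ : R →+* S} (hφ : Function.Injective φ) :
    Function.Injective (PolyEnd.map (n := n) φ) := fun a b h =>
  PolyEnd.ext (funext fun i => MvPolynomial.map_injective φ hφ (by
    rw [← PolyEnd.map_coord, ← PolyEnd.map_coord, h]))

theorem SAut.map_injective {φ : R →+* S} (hφ : Function.Injective φ) :
    Function.Injective (SAut.map (n := n) φ) := fun a b h =>
  SAut.toEnd_injective (PolyEnd.map_injective hφ (by
    rw [← SAut.toEnd_map, ← SAut.toEnd_map, h]))

theorem PolyEnd.degree_map_le (φ : R →+* S) (a : PolyEnd n R) :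
    (PolyEnd.map φ a).degree ≤ a.degree :=
  PolyEnd.degree_le_iff.2 fun i =>
    (Finset.sup_mono (support_map_subset φ (a.coord i))).trans (a.coord_totalDegree_le i)

theorem SAut.exists_map_eq {φ : R →+* S} (hφ : Function.Injective φ) {a : SAut n S}
    (h : (SAut.toEnd a).DefinedOver φ) (h' : (SAut.toEnd a⁻¹).DefinedOver φ) :
    ∃ b : SAut n R, SAut.map φ b = a := by
  obtain ⟨b, hb⟩ := PolyEnd.exists_map_eq h
  obtain ⟨b', hb'⟩ := PolyEnd.exists_map_eq h'
  have h1 : b * b' = 1 := PolyEnd.map_injective hφ (by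
    rw [map_mul, hb, hb', SAut.toEnd_mul_inv, map_one])
  have h2 : b' * b = 1 := PolyEnd.map_injective hφ (by
    rw [map_mul, hb, hb', SAut.toEnd_inv_mul, map_one])
  refine ⟨⟨⟨b, b', h1, h2⟩, ?_⟩, SAut.toEnd_injective hb⟩
  refine MvPolynomial.map_injective φ hφ ?_
  show MvPolynomial.map φ b.jac = _
  rw [← PolyEnd.jac_map, hb, SAut.jac_toEnd, map_one]

end Lift

end
end PolyAut

namespace PolyAut
open MvPolynomial

/-! ### Top-degree coefficients of composites -/

section TopDegree

variable {σ τ : Type*} {R : Type*} [CommRing R]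

theorem totalDegree_eval₂_C_le (g : σ → MvPolynomial τ R) {e : ℕ}
    (hg : ∀ i, (g i).totalDegree ≤ e) (p : MvPolynomial σ R) :
    (eval₂ C g p).totalDegree ≤ p.totalDegree * e := by
  rw [eval₂_eq]
  refine totalDegree_finsetSum_le fun d hd => (totalDegree_mul _ _).trans ?_
  rw [totalDegree_C, zero_add]
  refine (totalDegree_finsetProd _ _).trans ?_
  calc ∑ i ∈ d.support, (g i ^ d i).totalDegree ≤ ∑ i ∈ d.support, d i * e :=
        Finset.sum_le_sum fun i _ => (totalDegree_pow _ _).trans (Nat.mul_le_mul_left _ (hg i))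
    _ = (d.sum fun _ m => m) * e := by rw [← Finset.sum_mul]; rfl
    _ ≤ p.totalDegree * e := Nat.mul_le_mul_right _ (le_totalDegree hd)

theorem natDegree_prod_pow_le (Q : σ → Polynomial R) {e : ℕ}
    (hQ : ∀ i, (Q i).natDegree ≤ e) (d : σ → ℕ) (s : Finset σ) :
    (∏ i ∈ s, Q i ^ d i).natDegree ≤ (∑ i ∈ s, d i) * e := by
  rw [Finset.sum_mul]
  exact (Polynomial.natDegree_prod_le _ _).trans (Finset.sum_le_sum fun i _ =>
    Polynomial.natDegree_pow_le.trans (Nat.mul_le_mul_left _ (hQ i)))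

theorem coeff_prod_pow (Q : σ → Polynomial R) {e : ℕ}
    (hQ : ∀ i, (Q i).natDegree ≤ e) (d : σ → ℕ) (s : Finset σ) :
    (∏ i ∈ s, Q i ^ d i).coeff ((∑ i ∈ s, d i) * e) = ∏ i ∈ s, (Q i).coeff e ^ d i := by
  classical
  induction s using Finset.induction_on with
  | empty => simp
  | insert a s ha ih =>
    rw [Finset.prod_insert ha, Finset.sum_insert ha, Finset.prod_insert ha, add_mul,
      Polynomial.coeff_mul_add_eq_of_natDegree_le
        (Polynomial.natDegree_pow_le.trans (Nat.mul_le_mul_left _ (hQ a)))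
        (natDegree_prod_pow_le Q hQ d s), ih, Polynomial.coeff_pow_of_natDegree_le (hQ a)]

/-- The top coefficient of a polynomial in polynomials of degree at most `e`. -/
theorem coeff_eval₂_C (Q : σ → Polynomial R) {e : ℕ} (he : 0 < e)
    (hQ : ∀ i, (Q i).natDegree ≤ e) {p : MvPolynomial σ R} {d : ℕ} (hp : p.totalDegree ≤ d) :
    (eval₂ Polynomial.C Q p).coeff (d * e) =
      eval (fun i => (Q i).coeff e) (homogeneousComponent d p) := by
  rw [homogeneousComponent_apply, eval₂_eq, Polynomial.finsetSum_coeff, map_sum,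
    Finset.sum_filter]
  refine Finset.sum_congr rfl fun m hm => ?_
  rw [Polynomial.coeff_C_mul]
  have hm' : m.degree ≤ d := (le_totalDegree hm).trans hp
  split_ifs with h
  · subst h
    rw [eval_monomial]
    congr 1
    exact coeff_prod_pow Q hQ m m.support
  · rw [Polynomial.coeff_eq_zero_of_natDegree_lt, mul_zero]
    exact (natDegree_prod_pow_le Q hQ m m.support).trans_lt
      (Nat.mul_lt_mul_of_pos_right (lt_of_le_of_ne hm' h) he)

theorem natDegree_C_mul_X_le (a : R) : (Polynomial.C a * Polynomial.X).natDegree ≤ 1 :=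
  (Polynomial.natDegree_C_mul_le _ _).trans Polynomial.natDegree_X_le

theorem coeff_eval₂_line (v : σ → R) {p : MvPolynomial σ R} {d : ℕ} (hp : p.totalDegree ≤ d) :
    (eval₂ Polynomial.C (fun i => Polynomial.C (v i) * Polynomial.X) p).coeff d =
      eval v (homogeneousComponent d p) := by
  have := coeff_eval₂_C (fun i => Polynomial.C (v i) * Polynomial.X) one_pos
    (fun i => natDegree_C_mul_X_le (v i)) hp
  rw [mul_one] at this
  rw [this]
  simp

theorem natDegree_eval₂_le (Q : σ → Polynomial R) {e : ℕ}
    (hQ : ∀ i, (Q i).natDegree ≤ e) {p : MvPolynomial σ R} {d : ℕ} (hp : p.totalDegree ≤ d) :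
    (eval₂ Polynomial.C Q p).natDegree ≤ d * e := by
  rw [eval₂_eq]
  refine Polynomial.natDegree_sum_le_of_forall_le _ _ fun m hm => ?_
  refine (Polynomial.natDegree_C_mul_le _ _).trans ((natDegree_prod_pow_le Q hQ m m.support).trans
    (Nat.mul_le_mul_right _ ((le_totalDegree hm).trans hp)))

end TopDegree

/-! ### Zeros of the top forms are points of indeterminacy -/

section Indeterminacy

variable {n : ℕ} {k : Type u} [Field k]

theorem totalDegree_dehomogenization_le {m : ℕ} {h : MvPolynomial (Fin (n + 1)) k}
    (hh : h.IsHomogeneous m) :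
    (aeval (Fin.cons 1 X : Fin (n + 1) → MvPolynomial (Fin n) k) h).totalDegree ≤ m := by
  refine (totalDegree_eval₂_C_le (e := 1) _ (fun i => ?_) h).trans ?_
  · refine Fin.cases ?_ (fun j => ?_) i
    · simp
    · simp
  · simpa using hh.totalDegree_le

/-- Restrict h to the line (1, T v): the coefficient of T^m can be read off before or after
dehomogenizing. -/
theorem coeff_dehomogenization {m : ℕ} {h : MvPolynomial (Fin (n + 1)) k}
    (hh : h.IsHomogeneous m) (v : Fin n → k) :
    eval (Fin.cons 0 v : Fin (n + 1) → k) h = eval v (homogeneousComponent m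
      (aeval (Fin.cons 1 X : Fin (n + 1) → MvPolynomial (Fin n) k) h)) := by
  rw [← coeff_eval₂_line v (totalDegree_dehomogenization_le hh)]
  have h1 := coeff_eval₂_C (Fin.cons 1 fun i => Polynomial.C (v i) * Polynomial.X :
    Fin (n + 1) → Polynomial k) one_pos (fun i => by
      refine Fin.cases ?_ (fun j => ?_) i
      · simp
      · simpa using natDegree_C_mul_X_le (v j)) hh.totalDegree_le
  rw [mul_one, homogeneousComponent_eq_self hh] at h1
  convert! h1.symm using 2
  · congr 1
    funext i
    refine Fin.cases ?_ (fun j => ?_) i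
    · simp [Polynomial.coeff_one]
    · simp
  · rw [← coe_eval₂Hom, ← coe_eval₂Hom, aeval_def, ← coe_eval₂Hom]
    have : ((eval₂Hom Polynomial.C fun i => Polynomial.C (v i) * Polynomial.X).comp
        (eval₂Hom (algebraMap k (MvPolynomial (Fin n) k)) (Fin.cons 1 X))) =
        eval₂Hom Polynomial.C (Fin.cons 1 fun i => Polynomial.C (v i) * Polynomial.X :
          Fin (n + 1) → Polynomial k) := by
      ext i
      · simp
      · refine Fin.cases ?_ (fun j => ?_) i <;> simp
    exact DFunLike.congr_fun this h

theorem eq_zero_of_dehomogenization_eq_zero [Infinite k] {m : ℕ}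
    {h : MvPolynomial (Fin (n + 1)) k} (hh : h.IsHomogeneous m)
    (h0 : aeval (Fin.cons 1 X : Fin (n + 1) → MvPolynomial (Fin n) k) h = 0) : h = 0 := by
  have key : X 0 * h = 0 := by
    refine MvPolynomial.funext fun x => ?_
    rw [map_mul, eval_X, map_zero]
    by_cases hx : x 0 = 0
    · rw [hx, zero_mul]
    have h1 := eval₂_mul_of_isHomogeneous (RingHom.id k) (x 0)
      (Fin.cons 1 fun i => (x 0)⁻¹ * x i.succ : Fin (n + 1) → k) hh
    have h2 : eval₂ (RingHom.id k) (Fin.cons 1 fun i => (x 0)⁻¹ * x i.succ : Fin (n + 1) → k) h =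
        eval (fun i => (x 0)⁻¹ * x i.succ) (aeval (Fin.cons 1 X :
          Fin (n + 1) → MvPolynomial (Fin n) k) h) := by
      have : (eval fun i => (x 0)⁻¹ * x i.succ).comp
          (aeval (Fin.cons 1 X : Fin (n + 1) → MvPolynomial (Fin n) k)).toRingHom =
          eval₂Hom (RingHom.id k) (Fin.cons 1 fun i => (x 0)⁻¹ * x i.succ : Fin (n + 1) → k) := by
        ext i
        · simp
        · refine Fin.cases ?_ (fun j => ?_) i <;> simp
      exact (DFunLike.congr_fun this h).symm
    rw [h2, h0, map_zero, mul_zero] at h1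
    have h3 : (fun i => x 0 * (Fin.cons 1 fun i => (x 0)⁻¹ * x i.succ : Fin (n + 1) → k) i) = x := by
      funext i
      refine Fin.cases ?_ (fun j => ?_) i
      · simp
      · simp [hx]
    rw [h3] at h1
    have h4 : eval x h = 0 := h1
    rw [h4, mul_zero]
  exact (mul_eq_zero.1 key).resolve_left (X_ne_zero 0)

/-- A common zero at infinity of the components of top degree is a point of indeterminacy. -/
theorem mem_indeterminacy [Infinite k] {f : PolyEnd n k} (hd : 0 < f.degree) {v : Fin n → k}
    (hv : ∀ i, eval v (homogeneousComponent f.degree (f.coord i)) = 0)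
    (hv0 : (Fin.cons 0 v : Fin (n + 1) → k) ≠ 0) :
    Projectivization.mk k _ hv0 ∈ indeterminacy f := by
  intro m h hh
  obtain ⟨hhom, hne, hrep⟩ := hh
  set q := aeval (Fin.cons 1 X : Fin (n + 1) → MvPolynomial (Fin n) k) (h 0)
  have hq : q ≠ 0 := fun hq => hne (funext fun i => by
    refine eq_zero_of_dehomogenization_eq_zero (hhom i) ?_
    refine Fin.cases hq (fun j => ?_) i
    rw [hrep, hq, mul_zero])
  have hn : (Finset.univ : Finset (Fin n)).Nonempty := by
    rw [Finset.nonempty_iff_ne_empty]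
    intro he
    rw [PolyEnd.degree, he] at hd
    simp at hd
  obtain ⟨i₀, -, hi₀⟩ := Finset.exists_mem_eq_sup _ hn fun i => (f.coord i).totalDegree
  change f.degree = _ at hi₀
  have hfi : f.coord i₀ ≠ 0 := fun h0 => by rw [hi₀, h0, totalDegree_zero] at hd; omega
  -- The coordinate attaining the degree of f forces this bound. Hence q has no part of degree m,
  -- and the degree-m part of each fⱼ q is the top form of fⱼ times the part of q of degree m - deg
  -- f; all of these vanish at v.
  have hle : f.degree + q.totalDegree ≤ m := by
    rw [hi₀, ← totalDegree_mul_of_isDomain hfi hq, ← hrep]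
    exact totalDegree_dehomogenization_le (hhom _)
  have hcons : ∀ i, eval (Fin.cons 0 v : Fin (n + 1) → k) (h i) = 0 := by
    intro i
    rw [coeff_dehomogenization (hhom i)]
    refine Fin.cases ?_ (fun j => ?_) i
    · rw [homogeneousComponent_eq_zero _ _ (by change q.totalDegree < m; omega), map_zero]
    · rw [hrep j]
      have hdj := f.coord_totalDegree_le j
      rw [← coeff_eval₂_line v (d := m) ((totalDegree_mul _ _).trans (by
        change _ + q.totalDegree ≤ _; omega)), eval₂_mul]
      obtain ⟨e, rfl⟩ := Nat.exists_eq_add_of_le (show f.degree ≤ m by omega)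
      have hline : ∀ (p : MvPolynomial (Fin n) k) (d : ℕ), p.totalDegree ≤ d →
          (eval₂ Polynomial.C (fun i => Polynomial.C (v i) * Polynomial.X) p).natDegree ≤ d :=
        fun p d hp => (natDegree_eval₂_le _ (fun i => natDegree_C_mul_X_le (v i))
          hp).trans (mul_one d).le
      rw [Polynomial.coeff_mul_add_eq_of_natDegree_le (hline _ _ hdj)
        (hline q e (by omega)), coeff_eval₂_line v hdj, hv j, zero_mul]
  intro i
  obtain ⟨a, ha⟩ := Projectivization.exists_smul_eq_mk_rep k _ hv0
  rw [← ha]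
  have := eval₂_mul_of_isHomogeneous (RingHom.id k) (a : k) (Fin.cons 0 v : Fin (n + 1) → k) (hhom i)
  rw [show eval₂ (RingHom.id k) (Fin.cons 0 v : Fin (n + 1) → k) (h i) = 0 from hcons i,
    mul_zero] at this
  exact this

end Indeterminacy

/-! ### Dynamical regularity as an algebraic identity -/

section DynamicallyRegular

variable {n : ℕ} {k : Type u} [Field k]

theorem IsDynamicallyRegular.two_le_degree_inv {f : SAut n k}
    (hf : IsDynamicallyRegular (f : PAut n k)) : 2 ≤ (SAut.toEnd f⁻¹).degree := by
  by_contra h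
  have := SAut.degree_inv_le_one (a := f⁻¹) (by omega)
  rw [inv_inv] at this
  exact absurd (hf.1.trans this) (by norm_num)

theorem IsDynamicallyRegular.eq_zero [Infinite k] {f : SAut n k}
    (hf : IsDynamicallyRegular (f : PAut n k)) {v : Fin n → k}
    (h1 : ∀ i, eval v (homogeneousComponent (SAut.toEnd f).degree ((SAut.toEnd f).coord i)) = 0)
    (h2 : ∀ i, eval v
      (homogeneousComponent (SAut.toEnd f⁻¹).degree ((SAut.toEnd f⁻¹).coord i)) = 0) :
    v = 0 := by
  by_contra hv
  have hv0 : (Fin.cons 0 v : Fin (n + 1) → k) ≠ 0 := fun h => hv (funext fun i => by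
    have := congrFun h i.succ
    simpa using this)
  have h3 := hf.two_le_degree_inv
  exact Set.disjoint_left.1 hf.2
    (mem_indeterminacy (f := SAut.toEnd f) (Nat.zero_lt_two.trans_le hf.1) h1 hv0)
    (mem_indeterminacy (f := SAut.toEnd f⁻¹) (by omega) h2 hv0)

/-- The components of top degree of `f` and of `f⁻¹`. -/
noncomputable def topComponents (f : SAut n k) : Fin n ⊕ Fin n → MvPolynomial (Fin n) k :=
  Sum.elim (fun i => homogeneousComponent (SAut.toEnd f).degree ((SAut.toEnd f).coord i))
    (fun i => homogeneousComponent (SAut.toEnd f⁻¹).degree ((SAut.toEnd f⁻¹).coord i))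

theorem IsDynamicallyRegular.X_mem_radical [IsAlgClosed k] {f : SAut n k}
    (hf : IsDynamicallyRegular (f : PAut n k)) (i : Fin n) :
    X i ∈ (Ideal.span (Set.range (topComponents f))).radical := by
  have : Infinite k := IsAlgClosed.instInfinite
  rw [← vanishingIdeal_zeroLocus_eq_radical (K := k), mem_vanishingIdeal_iff]
  intro v hv
  rw [mem_zeroLocus_iff] at hv
  have h : ∀ j, eval v (topComponents f j) = 0 := fun j =>
    hv _ (Ideal.subset_span ⟨j, rfl⟩)
  have := hf.eq_zero (fun i => h (Sum.inl i)) (fun i => h (Sum.inr i))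
  simp [this]

/-- By the Nullstellensatz a power of each variable is a combination of the top forms, and this
identity persists in every domain over k. It will be applied to tuples of polynomials over a residue
field. -/
theorem IsDynamicallyRegular.eq_zero_of_eval₂ [IsAlgClosed k] {f : SAut n k}
    (hf : IsDynamicallyRegular (f : PAut n k)) {S : Type*} [CommRing S] [IsDomain S]
    (φ : k →+* S) (v : Fin n → S) (h : ∀ j, eval₂ φ v (topComponents f j) = 0) (i : Fin n) :
    v i = 0 := by
  obtain ⟨N, hN⟩ := hf.X_mem_radical i
  have h1 : Ideal.span (Set.range (topComponents f)) ≤ RingHom.ker (eval₂Hom φ v) := by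
    rw [Ideal.span_le]
    rintro _ ⟨j, rfl⟩
    exact h j
  have h2 := h1 hN
  rw [RingHom.mem_ker, map_pow, coe_eval₂Hom, eval₂_X] at h2
  exact eq_zero_of_pow_eq_zero h2

end DynamicallyRegular

end PolyAut

namespace PolyAut
open MvPolynomial IsLocalRing

/-! ### Conjugation over a valuation ring -/

section ValuationRing

variable {n : ℕ} {O L : Type u} [CommRing O] [IsDomain O] [ValuationRing O] [Field L]
  [Algebra O L] [IsFractionRing O L]

/-- A polynomial map with a pole can be rescaled so as to have a nonzero reduction. -/
theorem PolyEnd.exists_rescale {b : PolyEnd n L} (hb : ¬ b.DefinedOver (algebraMap O L)) :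
    ∃ (c : O) (b' : PolyEnd n O), c ≠ 0 ∧ c ∈ maximalIdeal O ∧
      (∀ i, MvPolynomial.map (algebraMap O L) (b'.coord i) =
        C (algebraMap O L c) * b.coord i) ∧
      ∃ i, MvPolynomial.map (residue O) (b'.coord i) ≠ 0 := by
  classical
  have hinj := IsFractionRing.injective O L
  let v := ValuationRing.valuation O L
  have hv : ∀ x : L, v x ≤ 1 ↔ ∃ a : O, algebraMap O L a = x := ValuationRing.mem_integer_iff O L
  simp only [PolyEnd.DefinedOver, not_forall] at hb
  obtain ⟨i₁, m₁, h₁⟩ := hb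
  let S : Finset (Fin n × (Fin n →₀ ℕ)) :=
    Finset.univ ×ˢ (Finset.univ.biUnion fun i => (b.coord i).support)
  have hS : ∀ i m, coeff m (b.coord i) ≠ 0 → (i, m) ∈ S := fun i m h => by
    simp only [S, Finset.mem_product, Finset.mem_univ, true_and, Finset.mem_biUnion]
    exact ⟨i, mem_support_iff.2 h⟩
  have h₁' : coeff m₁ (b.coord i₁) ≠ 0 := fun h => h₁ (by rw [h]; exact zero_mem _)
  -- Divide by the coefficient s of largest valuation: c = s⁻¹ lies in the maximal ideal because s
  -- is a pole, and the rescaled map has a coefficient equal to 1.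
  obtain ⟨⟨i₀, m₀⟩, -, hmax⟩ := Finset.exists_max_image S (fun s => v (coeff s.2 (b.coord s.1)))
    ⟨_, hS _ _ h₁'⟩
  set s := coeff m₀ (b.coord i₀)
  have hmax' : ∀ i m, v (coeff m (b.coord i)) ≤ v s := fun i m => by
    by_cases h : coeff m (b.coord i) = 0
    · rw [h, map_zero]; exact zero_le
    · exact hmax _ (hS i m h)
  have hs1 : ¬ v s ≤ 1 := fun h => h₁ ((hv _).1 ((hmax' i₁ m₁).trans h))
  have hs0 : s ≠ 0 := fun h => hs1 (by rw [h, map_zero]; exact zero_le)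
  have hvs : v s ≠ 0 := (Valuation.ne_zero_iff _).2 hs0
  obtain ⟨c, hc⟩ := (hv s⁻¹).1 (by
    rw [map_inv₀]
    exact inv_le_one_of_one_le₀ (not_le.1 hs1).le)
  have hb' : PolyEnd.DefinedOver (algebraMap O L) (⟨fun i => C s⁻¹ * b.coord i⟩ : PolyEnd n L) := by
    intro i m
    rw [coeff_C_mul]
    refine (hv _).1 ?_
    rw [map_mul, map_inv₀, mul_comm]
    exact mul_inv_le_one_of_le₀ (hmax' i m) zero_le
  obtain ⟨b', hb'⟩ := PolyEnd.exists_map_eq hb'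
  have hcoord : ∀ i, MvPolynomial.map (algebraMap O L) (b'.coord i) =
      C (algebraMap O L c) * b.coord i := fun i => by
    rw [← PolyEnd.map_coord, hb', hc]
  refine ⟨c, b', ?_, ?_, hcoord, i₀, fun h => ?_⟩
  · rintro rfl
    rw [map_zero] at hc
    exact inv_ne_zero hs0 hc.symm
  · rw [mem_maximalIdeal, mem_nonunits_iff]
    rintro ⟨w, rfl⟩
    refine hs1 ((hv _).2 ⟨(w⁻¹ : Oˣ), ?_⟩)
    rw [← inv_inv s, ← hc]
    refine eq_inv_of_mul_eq_one_left ?_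
    rw [← map_mul, Units.inv_mul, map_one]
  · have h1 : coeff m₀ (b'.coord i₀) = 1 := hinj (by
      rw [← coeff_map, hcoord, coeff_C_mul, hc, map_one, inv_mul_cancel₀ hs0])
    have h2 := congrArg (coeff m₀) h
    rw [coeff_map, h1, map_one, coeff_zero] at h2
    exact one_ne_zero h2

/-- An automorphism of Jacobian `1` without poles has an inverse without poles. -/
theorem SAut.definedOver_inv {a : SAut n L}
    (ha : (SAut.toEnd a).DefinedOver (algebraMap O L)) :
    (SAut.toEnd a⁻¹).DefinedOver (algebraMap O L) := by
  have hinj := IsFractionRing.injective O L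
  by_contra h
  obtain ⟨c, b, -, hc, hb, i₀, hi₀⟩ := PolyEnd.exists_rescale h
  obtain ⟨a', ha'⟩ := PolyEnd.exists_map_eq ha
  have hjac : a'.jac = 1 := MvPolynomial.map_injective _ hinj (by
    rw [← PolyEnd.jac_map, ha', SAut.jac_toEnd, map_one])
  have hjac' : (PolyEnd.map (residue O) a').jac = 1 := by rw [PolyEnd.jac_map, hjac, map_one]
  -- Since b = c a⁻¹, composing with a gives c x, which reduces to 0; dominance of the reduction of
  -- a then kills the reduction of b.
  have h1 : bind₁ a'.coord (b.coord i₀) = C c * X i₀ := MvPolynomial.map_injective _ hinj (by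
    rw [map_bind₁, hb, map_mul, algHom_C, map_mul, map_X, map_C]
    congr 1
    have := congrArg (fun e => e.coord i₀) (SAut.toEnd_inv_mul a)
    rw [← ha'] at this
    exact this)
  refine hi₀ (PolyEnd.bind₁_injective_of_jac_eq_one hjac' ?_)
  have h2 := congrArg (MvPolynomial.map (residue O)) h1
  rw [map_bind₁, map_mul, map_C, (residue_eq_zero_iff c).2 hc, C_0, zero_mul] at h2
  rw [map_zero]
  exact h2

/-- If the conjugate of `f` by `a` has no pole then `a` has no pole. -/
theorem IsDynamicallyRegular.exists_map_eq {k : Type u} [Field k] [IsAlgClosed k] {f : SAut n k}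
    (hf : IsDynamicallyRegular (f : PAut n k)) (φ : k →+* O) {a : SAut n L}
    (ha : (SAut.toEnd (a * SAut.map ((algebraMap O L).comp φ) f * a⁻¹)).DefinedOver
      (algebraMap O L)) :
    ∃ a' : SAut n O, SAut.map (algebraMap O L) a' = a := by
  have hinj := IsFractionRing.injective O L
  suffices h : (SAut.toEnd a⁻¹).DefinedOver (algebraMap O L) from
    SAut.exists_map_eq hinj (by simpa using SAut.definedOver_inv h) h
  by_contra hb
  obtain ⟨c, b, hc0, hc, hb, i₀, hi₀⟩ := PolyEnd.exists_rescale hb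
  have key : ∀ g : SAut n k, 2 ≤ (SAut.toEnd g).degree →
      (SAut.toEnd (a * SAut.map ((algebraMap O L).comp φ) g * a⁻¹)).DefinedOver
        (algebraMap O L) → ∀ i, eval₂ ((C.comp (residue O)).comp φ)
          (fun i => MvPolynomial.map (residue O) (b.coord i))
          (homogeneousComponent (SAut.toEnd g).degree ((SAut.toEnd g).coord i)) = 0 := by
    intro g hg hdef i
    obtain ⟨h, hh⟩ := PolyEnd.exists_map_eq hdef
    set d := (SAut.toEnd g).degree
    have h1 : SAut.toEnd (SAut.map ((algebraMap O L).comp φ) g) * SAut.toEnd a⁻¹ =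
        SAut.toEnd a⁻¹ * PolyEnd.map (algebraMap O L) h := by
      rw [hh, ← SAut.toEnd_mul, ← SAut.toEnd_mul]
      congr 1
      group
    have h2 : eval₂ (C.comp ((algebraMap O L).comp φ)) (SAut.toEnd a⁻¹).coord ((SAut.toEnd g).coord i) =
        bind₁ (PolyEnd.map (algebraMap O L) h).coord ((SAut.toEnd a⁻¹).coord i) := by
      have := congrArg (fun e => e.coord i) h1
      simp only [PolyEnd.mul_coord, SAut.toEnd_map, PolyEnd.map_coord] at this
      rw [← this, ← aeval_eq_bind₁, aeval_def, eval₂_map]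
      rfl
    -- Multiply g ∘ a⁻¹ = a⁻¹ ∘ h by c^d: one factor c turns a⁻¹ into b on the right, and since d ≥
    -- 2 a positive power of c remains to vanish in the residue field.
    have h3 : homogVal (C.comp φ) d ((SAut.toEnd g).coord i) (C c) b.coord =
        C c ^ (d - 1) * bind₁ h.coord (b.coord i) := by
      apply MvPolynomial.map_injective _ hinj
      rw [map_homogVal, map_mul, map_bind₁, hb, map_pow, map_C]
      simp only [hb]
      have h4 : (MvPolynomial.map (algebraMap O L)).comp (C.comp φ) =
          (C.comp ((algebraMap O L).comp φ) : k →+* MvPolynomial (Fin n) L) := by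
        ext x; simp
      rw [h4, homogVal_mul _ ((SAut.toEnd g).coord_totalDegree_le i), h2, map_mul, algHom_C,
        ← mul_assoc]
      congr 1
      rw [algebraMap_eq, ← pow_succ]
      congr 1
      omega
    have h5 := congrArg (MvPolynomial.map (residue O)) h3
    rw [map_homogVal, map_mul, map_pow, map_C, (residue_eq_zero_iff c).2 hc, C_0,
      zero_pow (by omega), zero_mul, homogVal_zero] at h5
    convert! h5 using 2
    ext x; simp
  refine hi₀ (hf.eq_zero_of_eval₂ ((C.comp (residue O)).comp φ)
    (fun i => MvPolynomial.map (residue O) (b.coord i)) (fun j => ?_) i₀)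
  rcases j with j | j
  · exact key f hf.1 ha j
  · refine key f⁻¹ hf.two_le_degree_inv ?_ j
    have := SAut.definedOver_inv ha
    convert! this using 2
    rw [map_inv]
    group

end ValuationRing

/-! ### Statement 1: the valuation ring k[[t]] -/

section Laurent

variable {n : ℕ} {k : Type u} [Field k]

theorem hasValue_iff_definedOver {F : PolyEnd n (LaurentSeries k)} :
    HasValue F ↔ F.DefinedOver (algebraMap (PowerSeries k) (LaurentSeries k)) := by
  refine forall_congr' fun i => forall_congr' fun m => ?_
  rw [RingHom.mem_range]
  set x : LaurentSeries k := coeff m (F.coord i)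
  constructor
  · intro h
    refine ⟨PowerSeries.mk fun j => HahnSeries.coeff x (j : ℤ), ?_⟩
    ext j
    rw [LaurentSeries.coe_algebraMap]
    rcases lt_or_ge j 0 with hj | hj
    · rw [h j hj, HahnSeries.ofPowerSeries_apply, HahnSeries.embDomain_of_notMem_range]
      rintro ⟨i, rfl⟩
      exact absurd hj (by simp)
    · obtain ⟨i, rfl⟩ := Int.eq_ofNat_of_zero_le hj
      rw [HahnSeries.ofPowerSeries_apply_coeff, PowerSeries.coeff_mk]
  · rintro ⟨y, hy⟩ j hj
    rw [← hy, LaurentSeries.coe_algebraMap, HahnSeries.ofPowerSeries_apply,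
      HahnSeries.embDomain_of_notMem_range]
    rintro ⟨i, rfl⟩
    exact absurd hj (by simp)

theorem value_map (a : PolyEnd n (PowerSeries k)) :
    value (PolyEnd.map (algebraMap (PowerSeries k) (LaurentSeries k)) a) =
      PolyEnd.map (PowerSeries.constantCoeff (R := k)) a := by
  ext1
  funext i
  ext m
  rw [value, PolyEnd.map_coord, coeff_map]
  have h : ∀ m', HahnSeries.coeff (coeff m' ((PolyEnd.map (algebraMap (PowerSeries k)
      (LaurentSeries k)) a).coord i)) 0 =
      PowerSeries.constantCoeff (coeff m' (a.coord i)) := fun m' => by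
    rw [PolyEnd.map_coord, coeff_map, LaurentSeries.coe_algebraMap]
    have := HahnSeries.ofPowerSeries_apply_coeff (Γ := ℤ) (coeff m' (a.coord i)) 0
    rwa [Nat.cast_zero, PowerSeries.coeff_zero_eq_constantCoeff_apply] at this
  simp only [coeff_sum, coeff_monomial, Finset.sum_ite_eq', h]
  split_ifs with hm
  · rfl
  · rw [notMem_support_iff] at hm
    rw [← h m, hm]
    rfl

theorem toLaurent_eq (f : SAut n k) :
    toLaurent f = SAut.map ((algebraMap (PowerSeries k) (LaurentSeries k)).comp
      (PowerSeries.C (R := k))) f := by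
  rw [toLaurent]
  refine congrArg (fun φ => SAut.map φ f) (RingHom.ext fun x => ?_)
  rw [RingHom.comp_apply, LaurentSeries.coe_algebraMap, HahnSeries.ofPowerSeries_C]

theorem SAut.map_map {R S T : Type u} [CommRing R] [CommRing S] [CommRing T]
    (φ : R →+* S) (ψ : S →+* T) (a : SAut n R) :
    SAut.map ψ (SAut.map φ a) = SAut.map (ψ.comp φ) a :=
  SAut.toEnd_injective (PolyEnd.ext (funext fun _ => MvPolynomial.map_map φ ψ _))

theorem SAut.map_id {R : Type u} [CommRing R] (a : SAut n R) :
    SAut.map (RingHom.id R) a = a :=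
  SAut.toEnd_injective (PolyEnd.ext (funext fun _ => MvPolynomial.map_id _))

theorem IsDynamicallyRegular.hasValue_conj [IsAlgClosed k] {f : SAut n k}
    (hf : IsDynamicallyRegular (f : PAut n k)) (α : SAut n (LaurentSeries k))
    (hα : HasValue (SAut.toEnd (α * toLaurent f * α⁻¹))) :
    HasValue (SAut.toEnd α) ∧
      ∃ a : SAut n k, SAut.toEnd a = value (SAut.toEnd α) ∧
        value (SAut.toEnd (α * toLaurent f * α⁻¹)) = SAut.toEnd (a * f * a⁻¹) := by
  rw [hasValue_iff_definedOver, toLaurent_eq] at hα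
  obtain ⟨α', rfl⟩ := hf.exists_map_eq _ hα
  refine ⟨hasValue_iff_definedOver.2 (PolyEnd.definedOver_map _ _),
    SAut.map (PowerSeries.constantCoeff (R := k)) α', ?_, ?_⟩
  · rw [SAut.toEnd_map, SAut.toEnd_map, value_map]
  · rw [toLaurent_eq, ← SAut.map_map, ← map_inv, ← map_mul, ← map_mul, SAut.toEnd_map, value_map,
      ← SAut.toEnd_map, map_mul, map_mul, map_inv, SAut.map_map]
    have : (PowerSeries.constantCoeff (R := k)).comp (PowerSeries.C (R := k)) = RingHom.id k := by
      ext x; simp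
    rw [this, SAut.map_id]

end Laurent

end PolyAut

namespace PolyAut
open MvPolynomial IsLocalRing

/-! ### Bounding the degree of the inverse -/

section InverseDegree

variable {n : ℕ} {k : Type u} [Field k]

theorem totalDegree_pow_eq {p : MvPolynomial (Fin n) k} (hp : p ≠ 0) (j : ℕ) :
    (p ^ j).totalDegree = j * p.totalDegree := by
  induction j with
  | zero => simp
  | succ j ih => rw [pow_succ, totalDegree_mul_of_isDomain (pow_ne_zero _ hp) hp, ih, add_mul, one_mul]

theorem prod_X_pow_eq_monomial (e : Fin n → ℕ) :
    (∏ l, X l ^ e l : MvPolynomial (Fin n) k) =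
      monomial (Finsupp.equivFunOnFinite.symm e) 1 := by
  rw [monomial_eq, C_1, one_mul, Finsupp.prod_fintype _ _ (fun i => pow_zero _)]
  rfl

/-- Sufficiently many monomials in `n + 1` polynomials in `n` variables are dependent. -/
theorem exists_sum_smul_eq_zero (a : Fin n → MvPolynomial (Fin n) k) {d N : ℕ}
    (ha : ∀ l, (a l).totalDegree ≤ d) (hN : (1 + n * d) ^ n < N) (i : Fin n) :
    ∃ q : Fin N × (Fin n → Fin N) → k, q ≠ 0 ∧
      ∑ s, q s • (X i ^ (s.1 : ℕ) * ∏ l, a l ^ (s.2 l : ℕ)) = 0 := by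
  classical
  set M := N * (1 + n * d)
  let w : Fin N × (Fin n → Fin N) → MvPolynomial (Fin n) k :=
    fun s => X i ^ (s.1 : ℕ) * ∏ l, a l ^ (s.2 l : ℕ)
  let Φ : (Fin N × (Fin n → Fin N) → k) →ₗ[k] MvPolynomial (Fin n) k := Fintype.linearCombination k w
  let Ψ : MvPolynomial (Fin n) k →ₗ[k] ((Fin n → Fin M) → k) :=
    LinearMap.pi fun e => lcoeff k (Finsupp.equivFunOnFinite.symm fun l => (e l : ℕ))
  -- There are N^(n+1) products, and polynomials with all exponents below M have M^n = N^n (1 +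
  -- nd)^n coefficients; the choice of N makes the former larger.
  have hcard : Module.finrank k ((Fin n → Fin M) → k) <
      Module.finrank k (Fin N × (Fin n → Fin N) → k) := by
    simp only [Module.finrank_fintype_fun_eq_card, Fintype.card_fun, Fintype.card_fin,
      Fintype.card_prod]
    have h0 : 0 < N := by omega
    rw [mul_pow, mul_comm N]
    exact Nat.mul_lt_mul_of_pos_left hN (pow_pos h0 n)
  obtain ⟨q, hq, hq0⟩ := (Submodule.ne_bot_iff _).1
    (LinearMap.ker_ne_bot_of_finrank_lt (f := Ψ ∘ₗ Φ) hcard)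
  refine ⟨q, hq0, ?_⟩
  have hΦ : Φ q = ∑ s, q s • w s := Fintype.linearCombination_apply k w q
  change ∑ s, q s • w s = 0
  have hw : ∀ s, (w s).totalDegree < M := fun s => by
    refine (totalDegree_mul _ _).trans_lt ?_
    have h1 : ((X i : MvPolynomial (Fin n) k) ^ (s.1 : ℕ)).totalDegree ≤ s.1 := by simp
    have h2 : (∏ l, a l ^ (s.2 l : ℕ)).totalDegree ≤ n * (N * d) := by
      refine (totalDegree_finsetProd _ _).trans ?_
      refine (Finset.sum_le_card_nsmul _ _ (N * d) fun l _ => ?_).trans (by simp)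
      exact (totalDegree_pow _ _).trans (Nat.mul_le_mul (s.2 l).2.le (ha l))
    have h3 := s.1.2
    have h4 : M = N + n * (N * d) := by simp only [M]; ring
    omega
  rw [← hΦ]
  ext m
  rw [coeff_zero]
  by_cases hm : ∀ l, m l < M
  · have := congrFun (LinearMap.mem_ker.1 hq) fun l => ⟨m l, hm l⟩
    simp only [LinearMap.comp_apply, Pi.zero_apply] at this
    rw [← this]
    change _ = coeff _ _
    congr 1
    ext l
    rfl
  · push Not at hm
    obtain ⟨l, hl⟩ := hm
    rw [hΦ, coeff_sum]
    refine Finset.sum_eq_zero fun s _ => ?_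
    rw [coeff_smul, coeff_eq_zero_of_totalDegree_lt, smul_zero]
    refine (hw s).trans_le (hl.trans ?_)
    by_cases hml : l ∈ m.support
    · exact Finset.single_le_sum (f := fun i => m i) (fun _ _ => Nat.zero_le _) hml
    · rw [Finsupp.notMem_support_iff.1 hml]; exact Nat.zero_le _

/-- The degree of the inverse of an automorphism is bounded in terms of its degree. -/
theorem exists_degree_inv_le (n d : ℕ) : ∃ B, ∀ a b : PolyEnd n k, a * b = 1 → b * a = 1 →
    a.degree ≤ d → b.degree ≤ B := by
  classical
  set N := (1 + n * d) ^ n + 1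
  refine ⟨n * N, fun a b hab hba ha => PolyEnd.degree_le_iff.2 fun i => ?_⟩
  by_contra! hP
  set P := b.coord i
  obtain ⟨q, hq0, hq⟩ := exists_sum_smul_eq_zero a.coord
    (fun l => (a.coord_totalDegree_le l).trans ha) (Nat.lt_succ_self _ : _ < N) i
  have hbX : bind₁ b.coord (X i) = P := bind₁_X_right _ _
  have hba' : ∀ l, bind₁ b.coord (a.coord l) = X l := fun l => congrArg (fun e => e.coord l) hab
  let Q : Fin N → MvPolynomial (Fin n) k := fun j => ∑ e : Fin n → Fin N,
    monomial (Finsupp.equivFunOnFinite.symm fun l => (e l : ℕ)) (q (j, e))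
  -- Substituting b turns the relation between xᵢ and the coordinates of a into an algebraic
  -- equation for P over k[x], with coefficients of degree at most nN. If deg P > nN, its highest
  -- nonzero term cannot cancel.
  have hsum : ∑ j, Q j * P ^ (j : ℕ) = 0 := by
    have h1 := congrArg (bind₁ b.coord) hq
    rw [map_zero, map_sum, Fintype.sum_prod_type] at h1
    rw [← h1]
    refine Finset.sum_congr rfl fun j _ => ?_
    rw [Finset.sum_mul]
    refine Finset.sum_congr rfl fun e _ => ?_
    rw [map_smul, map_mul, map_pow, hbX, map_prod]
    simp only [map_pow, hba', prod_X_pow_eq_monomial]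
    rw [mul_comm (P ^ _), ← smul_mul_assoc, smul_monomial, smul_eq_mul, mul_one]
  have hQdeg : ∀ j, (Q j).totalDegree ≤ n * N := fun j =>
    totalDegree_finsetSum_le fun e _ => by
      refine (totalDegree_monomial_le _ _).trans ?_
      rw [Finsupp.sum_fintype _ _ (fun _ => rfl)]
      exact (Finset.sum_le_card_nsmul _ _ N fun l _ => (e l).2.le).trans (by simp)
  have hQcoeff : ∀ j (e : Fin n → Fin N),
      coeff (Finsupp.equivFunOnFinite.symm fun l => (e l : ℕ)) (Q j) = q (j, e) := fun j e => by
    rw [coeff_sum, Finset.sum_eq_single e]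
    · rw [coeff_monomial, if_pos rfl]
    · intro e' _ he'
      rw [coeff_monomial, if_neg]
      intro h
      refine he' (funext fun l => Fin.ext ?_)
      exact congrFun (Finsupp.equivFunOnFinite.symm.injective h) l
    · simp
  have hex : ∃ j, Q j ≠ 0 := by
    obtain ⟨⟨j, e⟩, hje⟩ := Function.ne_iff.1 hq0
    exact ⟨j, fun h => hje (by rw [← hQcoeff, h, coeff_zero]; rfl)⟩
  obtain ⟨j₀, hj₀, hmax⟩ := Finset.exists_max_image (Finset.univ.filter fun j => Q j ≠ 0) id
    (by obtain ⟨j, hj⟩ := hex; exact ⟨j, by simpa using hj⟩)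
  have hj₀' : Q j₀ ≠ 0 := by simpa using hj₀
  have hP0 : P ≠ 0 := fun h => by rw [h, totalDegree_zero] at hP; omega
  have hdeg : (Q j₀ * P ^ (j₀ : ℕ)).totalDegree = (Q j₀).totalDegree + j₀ * P.totalDegree := by
    rw [totalDegree_mul_of_isDomain hj₀' (pow_ne_zero _ hP0), totalDegree_pow_eq hP0]
  rw [← Finset.add_sum_erase _ _ (Finset.mem_univ j₀)] at hsum
  have hother : ∀ j ∈ Finset.univ.erase j₀, Q j ≠ 0 → (j : ℕ) < j₀ := fun j hj hQj =>
    lt_of_le_of_ne (hmax j (by simpa using hQj)) fun h => (Finset.ne_of_mem_erase hj) (Fin.ext h)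
  rcases Nat.eq_zero_or_pos (j₀ : ℕ) with h0 | hpos
  · rw [Finset.sum_eq_zero, add_zero] at hsum
    · exact mul_ne_zero hj₀' (pow_ne_zero _ hP0) hsum
    · intro j hj
      by_contra h
      have := hother j hj (left_ne_zero_of_mul h)
      omega
  · have hsmall : (∑ j ∈ Finset.univ.erase j₀, Q j * P ^ (j : ℕ)).totalDegree ≤
        n * N + (j₀ - 1) * P.totalDegree := totalDegree_finsetSum_le fun j hj => by
      by_cases hQj : Q j = 0
      · rw [hQj, zero_mul, totalDegree_zero]; exact Nat.zero_le _
      · have := hother j hj hQj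
        exact (totalDegree_mul _ _).trans (Nat.add_le_add (hQdeg j)
          ((totalDegree_pow _ _).trans (Nat.mul_le_mul_right _ (by omega))))
    rw [add_eq_zero_iff_eq_neg] at hsum
    rw [← totalDegree_neg, ← hsum, hdeg] at hsmall
    obtain ⟨j', hj'⟩ := Nat.exists_eq_add_of_lt hpos
    rw [hj'] at hsmall
    simp only [zero_add, Nat.add_sub_cancel, add_mul, one_mul] at hsmall
    omega

end InverseDegree

/-! ### Families of bounded degree over the ring of all functions -/

section Families

variable {n : ℕ} {k : Type u} [Field k] {Z : Type u}

theorem exists_family {n D : ℕ} (p : Z → MvPolynomial (Fin n) k)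
    (hp : ∀ z, (p z).totalDegree ≤ D) :
    ∃ P : MvPolynomial (Fin n) (Z → k), ∀ z, MvPolynomial.map (Pi.evalRingHom _ z) P = p z := by
  classical
  refine ⟨∑ m ∈ (Finsupp.finite_of_degree_le (σ := Fin n) D).toFinset,
    monomial m fun z => coeff m (p z), fun z => ?_⟩
  ext m
  rw [coeff_map, coeff_sum]
  simp only [coeff_monomial, Finset.sum_ite_eq', Set.Finite.mem_toFinset, Set.mem_ofPred_eq]
  split_ifs with h
  · rfl
  · rw [map_zero]
    refine (coeff_eq_zero_of_totalDegree_lt ?_).symm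
    exact (hp z).trans_lt (not_le.1 h)

theorem family_ext {P Q : MvPolynomial (Fin n) (Z → k)}
    (h : ∀ z, MvPolynomial.map (Pi.evalRingHom (fun _ => k) z) P =
      MvPolynomial.map (Pi.evalRingHom _ z) Q) : P = Q := by
  ext m z
  have := congrArg (coeff m) (h z)
  simpa [coeff_map] using this

theorem PolyEnd.family_ext {a b : PolyEnd n (Z → k)}
    (h : ∀ z, PolyEnd.map (Pi.evalRingHom (fun _ => k) z) a =
      PolyEnd.map (Pi.evalRingHom _ z) b) : a = b :=
  PolyEnd.ext (funext fun i => PolyAut.family_ext fun z => by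
    rw [← PolyEnd.map_coord, h z, PolyEnd.map_coord])

theorem PolyEnd.exists_family {D : ℕ} (a : Z → PolyEnd n k) (ha : ∀ z, (a z).degree ≤ D) :
    ∃ b : PolyEnd n (Z → k), ∀ z, PolyEnd.map (Pi.evalRingHom _ z) b = a z := by
  have h : ∀ i, ∃ P : MvPolynomial (Fin n) (Z → k),
      ∀ z, MvPolynomial.map (Pi.evalRingHom _ z) P = (a z).coord i := fun i =>
    PolyAut.exists_family _ fun z => ((a z).coord_totalDegree_le i).trans (ha z)
  choose P hP using h
  exact ⟨⟨P⟩, fun z => PolyEnd.ext (funext fun i => hP i z)⟩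

theorem PolyEnd.degree_family_le {D : ℕ} {a : PolyEnd n (Z → k)}
    (h : ∀ z, (PolyEnd.map (Pi.evalRingHom (fun _ => k) z) a).degree ≤ D) : a.degree ≤ D := by
  refine PolyEnd.degree_le_iff.2 fun i => Finset.sup_le fun m hm => ?_
  obtain ⟨z, hz⟩ := Function.ne_iff.1 (mem_support_iff.1 hm)
  refine le_trans ?_ (((PolyEnd.map (Pi.evalRingHom (fun _ => k) z) a).coord_totalDegree_le i).trans
    (h z))
  refine le_totalDegree (mem_support_iff.2 ?_)
  rw [PolyEnd.map_coord, coeff_map]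
  exact hz

/-- The choice z ↦ g z need not be regular, only of bounded degree, so that finitely many monomials
occur. The uniform bound on the inverses is what makes the family invertible over `Z → k`. -/
theorem SAut.exists_family {d : ℕ} (g : Z → SAut n k) (hg : ∀ z, (SAut.toEnd (g z)).degree ≤ d) :
    ∃ G : SAut n (Z → k), (SAut.toEnd G).degree ≤ d ∧
      ∀ z, SAut.map (Pi.evalRingHom _ z) G = g z := by
  obtain ⟨B, hB⟩ := exists_degree_inv_le (k := k) n d
  obtain ⟨b, hb⟩ := PolyEnd.exists_family (fun z => SAut.toEnd (g z)) hg
  obtain ⟨b', hb'⟩ := PolyEnd.exists_family (fun z => SAut.toEnd (g z)⁻¹) fun z =>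
    hB _ _ (SAut.toEnd_mul_inv (g z)) (SAut.toEnd_inv_mul (g z)) (hg z)
  have h1 : b * b' = 1 := PolyEnd.family_ext fun z => by
    rw [map_mul, hb, hb', SAut.toEnd_mul_inv, map_one]
  have h2 : b' * b = 1 := PolyEnd.family_ext fun z => by
    rw [map_mul, hb, hb', SAut.toEnd_inv_mul, map_one]
  refine ⟨⟨⟨b, b', h1, h2⟩, ?_⟩, PolyEnd.degree_family_le fun z => ?_,
    fun z => SAut.toEnd_injective (hb z)⟩
  · refine PolyAut.family_ext fun z => ?_
    show MvPolynomial.map _ b.jac = _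
    rw [← PolyEnd.jac_map, hb, SAut.jac_toEnd, map_one]
  · show (PolyEnd.map _ b).degree ≤ d
    rw [hb]
    exact hg z

end Families

end PolyAut

namespace PolyAut
open MvPolynomial IsLocalRing

/-! ### Dominating valuation rings -/

section Domination

variable {R : Type*} {L : Type u} [CommRing R] [Field L]

/-- A prime-like ideal of a ring mapping to a field is dominated by a valuation ring. -/
theorem exists_valuationSubring_dominating (ρ : R →+* L) {I : Ideal R} (hI : I ≠ ⊤)
    (hker : RingHom.ker ρ ≤ I) :
    ∃ (O : Type u) (_ : CommRing O) (_ : IsDomain O) (_ : ValuationRing O) (_ : Algebra O L)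
      (_ : IsFractionRing O L) (ρ' : R →+* O), (algebraMap O L).comp ρ' = ρ ∧
      ∀ r ∈ I, ρ' r ∈ maximalIdeal O := by
  have hsurj : Function.Surjective ρ.rangeRestrict := ρ.rangeRestrict_surjective
  have h1 : I.map ρ.rangeRestrict ≠ ⊤ := by
    rw [Ne, Ideal.eq_top_iff_one, Ideal.mem_map_iff_of_surjective _ hsurj]
    rintro ⟨x, hx, hx1⟩
    have h2 : ρ x = 1 := congrArg Subtype.val hx1
    have h3 : x - 1 ∈ I := hker (by rw [RingHom.mem_ker, map_sub, h2, map_one, sub_self])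
    exact hI ((Ideal.eq_top_iff_one _).2 (by simpa using I.sub_mem hx h3))
  obtain ⟨V, hV, hI'⟩ := Ideal.image_subset_nonunits_valuationSubring _ h1
  refine ⟨V, inferInstance, inferInstance, inferInstance, inferInstance, inferInstance,
    ρ.codRestrict V fun x => hV ⟨x, rfl⟩, RingHom.ext fun x => rfl, fun r hr => ?_⟩
  have h2 : ρ r ∈ V.nonunits := hI' ⟨ρ.rangeRestrict r, Ideal.mem_map_of_mem _ hr, rfl⟩
  obtain ⟨_, h3⟩ := ValuationSubring.mem_nonunits_iff_exists_mem_maximalIdeal.1 h2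
  exact h3

end Domination

/-! ### Descent of conjugators to k -/

section Descent

variable {n : ℕ} {k : Type u} [Field k] [IsAlgClosed k]

theorem exists_algHom_of_finiteType (A : Type*) [CommRing A] [Nontrivial A] [Algebra k A]
    [Algebra.FiniteType k A] : Nonempty (A →ₐ[k] k) := by
  obtain ⟨M, hM⟩ := Ideal.exists_maximal A
  let := Ideal.Quotient.field M
  have : Module.Finite k (A ⧸ M) := finite_of_finite_type_of_isJacobsonRing k (A ⧸ M)
  have hbij := IsAlgClosed.algebraMap_bijective_of_isIntegral (k := k) (K := A ⧸ M)
  exact ⟨(AlgEquiv.ofBijective (Algebra.ofId k (A ⧸ M)) hbij).symm.toAlgHom.comp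
    (Ideal.Quotient.mkₐ k M)⟩

theorem PolyEnd.degree_map_eq {R S : Type u} [CommRing R] [CommRing S] {φ : R →+* S}
    (hφ : Function.Injective φ) (a : PolyEnd n R) : (PolyEnd.map φ a).degree = a.degree := by
  refine (PolyEnd.degree_map_le φ a).antisymm (PolyEnd.degree_le_iff.2 fun i => ?_)
  refine le_trans ?_ ((PolyEnd.map φ a).coord_totalDegree_le i)
  rw [PolyEnd.map_coord, totalDegree, totalDegree, support_map_of_injective _ hφ]

/-- Conjugators of bounded degree descend to an algebraically closed field. -/
theorem SAut.exists_conj_of_extension {E : Type u} [Field E] (ι : k →+* E) {f : SAut n k}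
    {h : PolyEnd n k} {d : ℕ} {G : SAut n E} (hG : (SAut.toEnd G).degree ≤ d)
    (hh : PolyEnd.map ι h = SAut.toEnd (G * SAut.map ι f * G⁻¹)) :
    ∃ g : SAut n k, (SAut.toEnd g).degree ≤ d ∧ h = SAut.toEnd (g * f * g⁻¹) := by
  classical
  let := ι.toAlgebra
  let T : Finset E := (Finset.univ.biUnion fun i => ((toEnd G).coord i).coeffs) ∪
    (Finset.univ.biUnion fun i => ((toEnd G⁻¹).coord i).coeffs)
  -- G and its inverse live over this finitely generated algebra, whose k-points specialize G to k;
  -- h and f, having coefficients in k, are unchanged.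
  let B := Algebra.adjoin k (T : Set E)
  have hBft : Algebra.FiniteType k B :=
    (Subalgebra.fg_iff_finiteType B).1 ⟨T, rfl⟩
  have hsub : ∀ x : E, x = 0 ∨ x ∈ T → x ∈ (algebraMap B E).range := by
    rintro x (rfl | hx)
    · exact zero_mem _
    · exact ⟨⟨x, Algebra.subset_adjoin hx⟩, rfl⟩
  have hinj : Function.Injective (algebraMap B E) := Subtype.val_injective
  obtain ⟨G', hG'⟩ := SAut.exists_map_eq (φ := algebraMap B E) hinj (a := G)
    (fun i m => hsub _ (by
      by_cases h0 : coeff m ((toEnd G).coord i) = 0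
      · exact Or.inl h0
      · refine Or.inr (Finset.mem_union_left _ (Finset.mem_biUnion.2 ⟨i, Finset.mem_univ _, ?_⟩))
        exact coeff_mem_coeffs _ h0))
    (fun i m => hsub _ (by
      by_cases h0 : coeff m ((toEnd G⁻¹).coord i) = 0
      · exact Or.inl h0
      · refine Or.inr (Finset.mem_union_right _ (Finset.mem_biUnion.2 ⟨i, Finset.mem_univ _, ?_⟩))
        exact coeff_mem_coeffs _ h0))
  obtain ⟨χ⟩ := exists_algHom_of_finiteType (k := k) B
  have hcomp : (algebraMap B E).comp (algebraMap k B) = ι := rfl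
  have hχ : (χ : B →+* k).comp (algebraMap k B) = RingHom.id k := by
    ext x; simp
  have hB : PolyEnd.map (algebraMap k B) h =
      toEnd (G' * SAut.map (algebraMap k B) f * G'⁻¹) := by
    apply PolyEnd.map_injective hinj
    rw [← toEnd_map, map_mul, map_mul, map_inv, hG', SAut.map_map, hcomp, ← hh]
    exact PolyEnd.ext (funext fun i => MvPolynomial.map_map _ _ _)
  refine ⟨SAut.map (χ : B →+* k) G', ?_, ?_⟩
  · refine (PolyEnd.degree_map_le _ (toEnd G')).trans ?_
    rw [← PolyEnd.degree_map_eq hinj (toEnd G'), ← toEnd_map, hG']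
    exact hG
  · have := congrArg (PolyEnd.map (χ : B →+* k)) hB
    rw [← toEnd_map, map_mul, map_mul, map_inv, SAut.map_map, hχ, SAut.map_id] at this
    rw [← this]
    refine PolyEnd.ext (funext fun i => ?_)
    rw [PolyEnd.map_coord, PolyEnd.map_coord, MvPolynomial.map_map, hχ, MvPolynomial.map_id]

end Descent

/-! ### Specializing conjugates of bounded degree -/

section Closed

variable {n : ℕ} {k : Type u} [Field k] [IsAlgClosed k]

theorem PolyEnd.map_map {R S T : Type u} [CommRing R] [CommRing S] [CommRing T]
    (φ : R →+* S) (ψ : S →+* T) (a : PolyEnd n R) :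
    PolyEnd.map ψ (PolyEnd.map φ a) = PolyEnd.map (ψ.comp φ) a :=
  PolyEnd.ext (funext fun _ => MvPolynomial.map_map φ ψ _)

/-- Conjugates of `f` by elements of bounded degree specialize to conjugates of `f` by elements
of bounded degree. -/
theorem IsDynamicallyRegular.exists_conj_of_specialization {f : SAut n k}
    (hf : IsDynamicallyRegular (f : PAut n k)) {d : ℕ} {R : Type u} [CommRing R] (ε : k →+* R)
    (F : PolyEnd n R) {e₀ : R →+* k} (he₀ : e₀.comp ε = RingHom.id k) {Z : Type u}
    (e : Z → R →+* k) (he : ∀ z, (e z).comp ε = RingHom.id k)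
    (hdense : ∀ s, e₀ s ≠ 0 → ∃ z, e z s ≠ 0)
    (hZ : ∀ z, ∃ g : SAut n k, (SAut.toEnd g).degree ≤ d ∧
      PolyEnd.map (e z) F = SAut.toEnd (g * f * g⁻¹)) :
    ∃ g : SAut n k, (SAut.toEnd g).degree ≤ d ∧
      PolyEnd.map e₀ F = SAut.toEnd (g * f * g⁻¹) := by
  choose g hgd hg using hZ
  obtain ⟨G, hGd, hG⟩ := SAut.exists_family g hgd
  let ê : R →+* (Z → k) := RingHom.pi e
  -- These are the restrictions to Z of the elements not vanishing at e₀. By density none of them is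
  -- zero, so some prime P avoids them all: its residue domain plays the role of a generic point of
  -- Z that specializes to e₀.
  let S : Submonoid (Z → k) := (Submonoid.comap (e₀ : R →* k) (nonZeroDivisors k)).map (ê : R →* (Z → k))
  have hdisj : Disjoint ((⊥ : Ideal (Z → k)) : Set (Z → k)) S := by
    rw [Set.disjoint_left]
    rintro x hx ⟨s, hs, rfl⟩
    obtain ⟨z, hz⟩ := hdense s (nonZeroDivisors.ne_zero hs)
    exact hz (congrFun (show ê s = 0 from hx) z)
  obtain ⟨P, hP, -, hPS⟩ := Ideal.exists_le_prime_disjoint _ S hdisj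
  let L := FractionRing ((Z → k) ⧸ P)
  let ψ : (Z → k) →+* L := (algebraMap ((Z → k) ⧸ P) L).comp (Ideal.Quotient.mk P)
  have hψ : ∀ x, ψ x = 0 → x ∈ P := fun x hx => by
    rw [← Ideal.Quotient.eq_zero_iff_mem]
    exact IsFractionRing.injective ((Z → k) ⧸ P) L (by rw [map_zero]; exact hx)
  have hker : RingHom.ker (ψ.comp ê) ≤ RingHom.ker e₀ := fun s hs => by
    by_contra h
    exact Set.disjoint_left.1 hPS (hψ _ hs)
      ⟨s, mem_nonZeroDivisors_of_ne_zero h, rfl⟩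
  obtain ⟨V, _, _, _, _, _, ρ, hρ, hmax⟩ := exists_valuationSubring_dominating (ψ.comp ê)
    (RingHom.ker_ne_top e₀) hker
  have hconst : (ψ.comp ê).comp ε = ψ.comp (Pi.constRingHom Z k) := by
    rw [RingHom.comp_assoc]
    congr 1
    ext x z
    exact DFunLike.congr_fun (he z) x
  have hF : PolyEnd.map ê F = SAut.toEnd (G * SAut.map (Pi.constRingHom Z k) f * G⁻¹) :=
    PolyEnd.family_ext fun z => by
      rw [PolyEnd.map_map, ← SAut.toEnd_map, map_mul, map_mul, map_inv, hG, SAut.map_map]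
      have h1 : (Pi.evalRingHom (fun _ => k) z).comp (Pi.constRingHom Z k) = RingHom.id k := rfl
      rw [h1, SAut.map_id, ← hg z]
      rfl
  have hφ : (algebraMap V L).comp (ρ.comp ε) = ψ.comp (Pi.constRingHom Z k) := by
    rw [← RingHom.comp_assoc, hρ, hconst]
  have hFL : PolyEnd.map (algebraMap V L) (PolyEnd.map ρ F) =
      SAut.toEnd (SAut.map ψ G * SAut.map ((algebraMap V L).comp (ρ.comp ε)) f *
        (SAut.map ψ G)⁻¹) := by
    rw [PolyEnd.map_map, hρ, ← PolyEnd.map_map, hF, ← SAut.toEnd_map, map_mul, map_mul, map_inv,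
      SAut.map_map, hφ]
  obtain ⟨G', hG'⟩ := hf.exists_map_eq (O := V) (L := L) (ρ.comp ε) (a := SAut.map ψ G) (by
    rw [← hFL]; exact PolyEnd.definedOver_map _ _)
  have hinj : Function.Injective (algebraMap V L) := IsFractionRing.injective V L
  have hFV : PolyEnd.map ρ F = SAut.toEnd (G' * SAut.map (ρ.comp ε) f * G'⁻¹) :=
    PolyEnd.map_injective hinj (by
      rw [hFL, ← SAut.toEnd_map, map_mul, map_mul, map_inv, hG', SAut.map_map])
  let ι : k →+* ResidueField V := (residue V).comp (ρ.comp ε)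
  -- Each s differs from the constant e₀ s by an element of ker e₀, which lands in the maximal
  -- ideal; so F reduces to the base change of its fibre at e₀.
  have hι : (residue V).comp ρ = ι.comp e₀ := by
    ext s
    have h1 : s - ε (e₀ s) ∈ RingHom.ker e₀ := by
      rw [RingHom.mem_ker, map_sub, ← RingHom.comp_apply, he₀, RingHom.id_apply, sub_self]
    have h2 := (residue_eq_zero_iff _).2 (hmax _ h1)
    rw [map_sub, map_sub, sub_eq_zero] at h2
    exact h2
  refine SAut.exists_conj_of_extension ι (G := SAut.map (residue V) G') ?_ ?_
  · refine (PolyEnd.degree_map_le _ (SAut.toEnd G')).trans ?_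
    rw [← PolyEnd.degree_map_eq hinj (SAut.toEnd G'), ← SAut.toEnd_map, hG']
    exact (PolyEnd.degree_map_le _ (SAut.toEnd G)).trans hGd
  · rw [PolyEnd.map_map, ← hι, ← PolyEnd.map_map, hFV, ← SAut.toEnd_map, map_mul, map_mul, map_inv,
      SAut.map_map]

end Closed

end PolyAut

namespace PolyAut
open MvPolynomial IsLocalRing AlgebraicGeometry CategoryTheory

/-! ### Points and affine charts of varieties -/

namespace Variety

variable {k : Type u} [Field k]

/-- The structure map `k → k[A]`. -/
noncomputable def const (A : Variety k) : k →+* A.functions :=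
  A.str.appTop.hom.comp (Scheme.ΓSpecIso (CommRingCat.of k)).inv.hom

theorem Point.ev_comp_const {A : Variety k} (x : A.Point) :
    x.ev.comp A.const = RingHom.id k := by
  have h : (Scheme.ΓSpecIso (CommRingCat.of k)).inv ≫ A.str.appTop ≫ x.hom.appTop ≫
      (Scheme.ΓSpecIso (CommRingCat.of k)).hom = 𝟙 _ := by
    rw [← Scheme.Hom.comp_appTop_assoc, x.hom_str, Scheme.Hom.id_appTop, Category.id_comp,
      Iso.inv_hom_id]
  ext c
  exact congrArg (fun φ => φ.hom c) h

theorem closedPoint_mem_basicOpen (r : Γ(Spec (CommRingCat.of k), ⊤)) :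
    closedPoint k ∈ (Spec (CommRingCat.of k)).basicOpen r ↔
      (Scheme.ΓSpecIso (CommRingCat.of k)).hom.hom r ≠ 0 := by
  obtain ⟨c, rfl⟩ : ∃ c, r = (Scheme.ΓSpecIso (CommRingCat.of k)).inv.hom c :=
    ⟨(Scheme.ΓSpecIso (CommRingCat.of k)).hom.hom r, by
      simp⟩
  rw [basicOpen_eq_of_affine]
  have : (Scheme.ΓSpecIso (CommRingCat.of k)).hom.hom
      ((Scheme.ΓSpecIso (CommRingCat.of k)).inv.hom c) = c := by simp
  rw [this]
  change c ∉ maximalIdeal k ↔ _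
  rw [IsLocalRing.mem_maximalIdeal, mem_nonunits_iff, not_not, isUnit_iff_ne_zero]

theorem isOpen_ev_ne_zero {A : Variety k} (s : A.functions) :
    IsOpen {x : A.Point | x.ev s ≠ 0} := by
  refine isOpen_induced_iff.2 ⟨A.X.basicOpen s, (A.X.basicOpen s).2, ?_⟩
  ext x
  change closedPoint k ∈ x.hom ⁻¹ᵁ A.X.basicOpen s ↔ _
  rw [Scheme.preimage_basicOpen]
  exact closedPoint_mem_basicOpen _

theorem Point.ext {A : Variety k} {x y : A.Point} (h : x.hom = y.hom) : x = y := by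
  cases x; cases y; cases h; rfl

/-- Affine charts of a variety, on the level of points. -/
theorem exists_chart (A : Variety k) (x : A.Point) :
    ∃ (R : Type u) (_ : CommRing R) (_ : Algebra k R) (_ : Algebra.FiniteType k R)
      (pt : (R →ₐ[k] k) → A.Point),
      (∃ y, pt y = x) ∧
      (∀ C : Set A.Point, IsClosed C → ∃ J : Ideal R, ∀ y, pt y ∈ C ↔ ∀ s ∈ J, y s = 0) ∧
      ∀ u : R, IsOpen (pt '' {y | y u ≠ 0}) := by
  obtain ⟨R, j, _, hxj, -⟩ := Scheme.exists_affine_mem_range_and_range_subset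
    (X := A.X) (x := x.toPt) (U := ⊤) trivial
  have hft := A.locallyOfFiniteType
  let ε : CommRingCat.of k ⟶ R := Spec.preimage (j ≫ A.str)
  have hε : Spec.map ε = j ≫ A.str := Spec.map_preimage _
  let alg : Algebra k R := ε.hom.toAlgebra
  have hR : Algebra.FiniteType k R := by
    have : LocallyOfFiniteType (Spec.map ε) := by rw [hε]; infer_instance
    exact HasRingHomProperty.Spec_iff.mp this
  let pt : (R →ₐ[k] k) → A.Point := fun y =>
    ⟨Spec.map (CommRingCat.ofHom (y : R →+* k)) ≫ j, by
      rw [Category.assoc, ← hε, ← Spec.map_comp, ← Spec.map_id]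
      congr 1
      ext c
      exact y.commutes c⟩
  have hpt : ∀ y, (pt y).toPt = j (PrimeSpectrum.comap (y : R →+* k) (closedPoint k)) :=
    fun y => rfl
  have hmem : ∀ (y : R →ₐ[k] k) (s : R),
      s ∈ (PrimeSpectrum.comap (y : R →+* k) (closedPoint k)).asIdeal ↔ y s = 0 := fun y s => by
    change y s ∈ maximalIdeal k ↔ _
    rw [IsLocalRing.mem_maximalIdeal, mem_nonunits_iff, isUnit_iff_ne_zero, not_not]
  have hsurj : ∀ z : A.Point, z.toPt ∈ Set.range j → ∃ y, pt y = z := by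
    intro z hz
    have hrange : Set.range z.hom ⊆ Set.range j := by
      rintro _ ⟨p, rfl⟩
      rwa [show p = closedPoint k from Subsingleton.elim _ _]
    let l := IsOpenImmersion.lift j z.hom hrange
    have hl : l ≫ j = z.hom := IsOpenImmersion.lift_fac j z.hom hrange
    let y := Spec.preimage l
    have hy : Spec.map y = l := Spec.map_preimage _
    have hcomp : ε ≫ y = 𝟙 _ := by
      apply Spec.map_injective
      rw [Spec.map_comp, hy, hε, ← Category.assoc, hl, z.hom_str, Spec.map_id]
    let y' : R →ₐ[k] k := { y.hom with commutes' := fun c => congrArg (fun φ => φ.hom c) hcomp }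
    refine ⟨y', Point.ext ?_⟩
    change Spec.map y ≫ j = z.hom
    rw [hy, hl]
  refine ⟨R, inferInstance, alg, hR, pt, hsurj x hxj, fun C hC => ?_, fun u => ?_⟩
  · obtain ⟨C', hC', rfl⟩ := isClosed_induced_iff.1 hC
    obtain ⟨J, hJ⟩ := (PrimeSpectrum.isClosed_iff_zeroLocus_ideal _).1
      (hC'.preimage j.continuous)
    refine ⟨J, fun y => ?_⟩
    have : pt y ∈ Point.toPt ⁻¹' C' ↔ PrimeSpectrum.comap (y : R →+* k) (closedPoint k) ∈
        j ⁻¹' C' := Iff.rfl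
    rw [this, hJ]
    change (∀ s, s ∈ J → _) ↔ _
    exact forall₂_congr fun s _ => hmem y s
  · refine isOpen_induced_iff.2 ⟨j '' (PrimeSpectrum.basicOpen u : Set (PrimeSpectrum R)),
      j.isOpenEmbedding.isOpenMap _ (PrimeSpectrum.basicOpen u).2, ?_⟩
    ext z
    constructor
    · intro hz
      obtain ⟨p, hp, hpz⟩ := hz
      obtain ⟨y, rfl⟩ := hsurj z ⟨p, hpz⟩
      refine ⟨y, fun h => hp ?_, rfl⟩
      rw [hpt] at hpz
      rw [j.isOpenEmbedding.injective hpz]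
      exact (hmem y u).2 h
    · rintro ⟨y, hy, rfl⟩
      exact ⟨_, fun h => hy ((hmem y u).1 h), (hpt y).symm⟩

end Variety

/-! ### Statement 2: closedness in bounded degree -/

section Topology

variable {n : ℕ} {k : Type u} [Field k]

theorem isClosed_PAut_iff {T : Set (PAut n k)} :
    IsClosed T ↔ ∀ (A : Variety k) (F : PAut n A.functions), IsClosed (PAut.fiber F ⁻¹' T) := by
  rw [← isOpen_compl_iff]
  change (∀ (A : Variety k) (F : PAut n A.functions), IsClosed (PAut.fiber F ⁻¹' Tᶜᶜ)) ↔ _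
  rw [compl_compl]

/-- The topology is induced from `PAut`, so test families may leave `SAut`; hence F is not required
to have Jacobian 1. -/
theorem SAut.isClosed_of_forall {T : Set (SAut n k)}
    (h : ∀ (A : Variety k) (F : PolyEnd n A.functions),
      IsClosed {x : A.Point | ∃ g ∈ T, PolyEnd.map x.ev F = SAut.toEnd g}) : IsClosed T := by
  refine isClosed_induced_iff.2 ⟨Subtype.val '' T, isClosed_PAut_iff.2 fun A F => ?_,
    Set.preimage_image_eq _ Subtype.val_injective⟩
  convert! h A F.1 using 1
  ext x
  constructor
  · rintro ⟨g, hg, hgF⟩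
    exact ⟨g, hg, congrArg Units.val hgF.symm⟩
  · rintro ⟨g, hg, hgF⟩
    exact ⟨g, hg, Units.ext hgF.symm⟩

end Topology

section Closed

variable {n : ℕ} {k : Type u} [Field k] [IsAlgClosed k]

/-- A global regular function that is nonzero at a closure point is nonzero somewhere on the set.
This is all the density that specialization needs, so no affine chart enters. -/
theorem IsDynamicallyRegular.isClosed_setOf_conj {f : SAut n k}
    (hf : IsDynamicallyRegular (f : PAut n k)) (d : ℕ) {A : Variety k}
    (F : PolyEnd n A.functions) :
    IsClosed {x : A.Point | ∃ g : SAut n k, (SAut.toEnd g).degree ≤ d ∧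
      PolyEnd.map x.ev F = SAut.toEnd (g * f * g⁻¹)} := by
  set C := {x : A.Point | ∃ g : SAut n k, (SAut.toEnd g).degree ≤ d ∧
      PolyEnd.map x.ev F = SAut.toEnd (g * f * g⁻¹)}
  refine isClosed_of_closure_subset fun x hx => ?_
  refine hf.exists_conj_of_specialization A.const F x.ev_comp_const (Z := C) (fun z => z.1.ev)
    (fun z => z.1.ev_comp_const) (fun s hs => ?_) (fun z => z.2)
  obtain ⟨z, hz, hzC⟩ := mem_closure_iff.1 hx _ (Variety.isOpen_ev_ne_zero s) hs
  exact ⟨⟨z, hzC⟩, hz⟩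

theorem IsDynamicallyRegular.isClosed_conj_degree_le {f : SAut n k}
    (hf : IsDynamicallyRegular (f : PAut n k)) (d : ℕ) :
    IsClosed {h : SAut n k | ∃ g : SAut n k, (SAut.toEnd g).degree ≤ d ∧ h = g * f * g⁻¹} := by
  refine SAut.isClosed_of_forall fun A F => ?_
  convert! hf.isClosed_setOf_conj d F using 1
  ext x
  constructor
  · rintro ⟨_, ⟨g, hg, rfl⟩, hx⟩
    exact ⟨g, hg, hx⟩
  · rintro ⟨g, hg, hx⟩
    exact ⟨_, ⟨g, hg, rfl⟩, hx⟩

end Closed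

end PolyAut

namespace PolyAut
open MvPolynomial

/-! ### A Nullstellensatz for countably many conditions -/

section Uncountable

variable {k : Type u} [Field k] [IsAlgClosed k] [Uncountable k]

open Cardinal in
/-- The Nullstellensatz for algebras of countable dimension over an uncountable field. -/
theorem exists_algHom_of_rank_le (A : Type u) [CommRing A] [Nontrivial A] [Algebra k A]
    (hA : Module.rank k A ≤ ℵ₀) : Nonempty (A →ₐ[k] k) := by
  obtain ⟨M, hM⟩ := Ideal.exists_maximal A
  let := Ideal.Quotient.field M
  have hrank : Module.rank k (A ⧸ M) ≤ ℵ₀ :=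
    (LinearMap.rank_le_of_surjective (Ideal.Quotient.mkₐ k M).toLinearMap
      (Ideal.Quotient.mkₐ_surjective k M)).trans hA
  have halg : Algebra.IsAlgebraic k (A ⧸ M) := by
    by_contra h
    rw [← Algebra.transcendental_iff_not_isAlgebraic] at h
    obtain ⟨x, hx⟩ := h.transcendental
    -- For x transcendental the elements 1/(x - c), with c in k, are independent, and there are
    -- uncountably many.
    have := hx.linearIndependent_sub_inv.cardinal_le_rank.trans hrank
    exact not_countable (α := k) (mk_le_aleph0_iff.1 this)
  have hbij := IsAlgClosed.algebraMap_bijective_of_isIntegral (k := k) (K := A ⧸ M)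
  exact ⟨(AlgEquiv.ofBijective (Algebra.ofId k (A ⧸ M)) hbij).symm.toAlgHom.comp
    (Ideal.Quotient.mkₐ k M)⟩

theorem countable_closure {M : Type*} [Monoid M] {T : Set M} (hT : T.Countable) :
    Countable (Submonoid.closure T) := by
  have : Countable T := hT
  rw [Submonoid.closure_eq_mrange]
  have : Countable (FreeMonoid T) := inferInstanceAs (Countable (List T))
  exact (Set.countable_range (FreeMonoid.lift ((↑) : T → M))).to_subtype

/-- Countably many principal open subsets of an affine variety over an uncountable field have a
common point if any finitely many of them have one. -/
theorem exists_algHom_ne_zero {R : Type u} [CommRing R] [Algebra k R] [Algebra.FiniteType k R]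
    (I : Ideal R) {T : Set R} (hT : T.Countable) (hI : ∀ t ∈ Submonoid.closure T, t ∉ I) :
    ∃ y : R →ₐ[k] k, (∀ a ∈ I, y a = 0) ∧ ∀ t ∈ T, y t ≠ 0 := by
  let q := Ideal.Quotient.mkₐ k I
  let S : Submonoid (R ⧸ I) := (Submonoid.closure T).map q
  have hS : Countable S := by
    have := countable_closure hT
    exact (Set.to_countable (Submonoid.closure T : Set R)).image q
  let A := Localization S
  have hnt : Nontrivial A := by
    by_contra h
    rw [not_nontrivial_iff_subsingleton] at h
    obtain ⟨t, ht, ht0⟩ := (IsLocalization.subsingleton_iff (M := S) (S := A)).1 h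
    exact hI t ht (Ideal.Quotient.eq_zero_iff_mem.1 ht0)
  obtain ⟨m, π, hπ⟩ := Algebra.FiniteType.iff_quotient_mvPolynomial''.1
    (inferInstance : Algebra.FiniteType k (R ⧸ I))
  -- Monomials over countably many denominators: a countable spanning family of the localization.
  let w : (Fin m →₀ ℕ) × S → A := fun s => IsLocalization.mk' A (π (monomial s.1 1)) s.2
  have hspan : Submodule.span k (Set.range w) = ⊤ := by
    rw [eq_top_iff]
    rintro a -
    obtain ⟨⟨r, s⟩, rfl⟩ := IsLocalization.mk'_surjective S a
    obtain ⟨p, rfl⟩ := hπ r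
    change IsLocalization.mk' A (π p) s ∈ _
    induction p using MvPolynomial.induction_on' with
    | monomial d c =>
      have : π (monomial d c) = c • π (monomial d 1) := by
        rw [← map_smul, smul_monomial, smul_eq_mul, mul_one]
      rw [this, IsLocalization.mk'_eq_mul_mk'_one, Algebra.algebraMap_eq_smul_one, smul_assoc,
        smul_mul_assoc, ← Algebra.algebraMap_eq_smul_one, ← IsLocalization.mk'_eq_mul_mk'_one]
      exact Submodule.smul_mem _ _ (Submodule.subset_span ⟨(d, s), rfl⟩)
    | add p p' hp hp' =>
      rw [map_add, IsLocalization.mk'_eq_mul_mk'_one, map_add, add_mul,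
        ← IsLocalization.mk'_eq_mul_mk'_one, ← IsLocalization.mk'_eq_mul_mk'_one]
      exact Submodule.add_mem _ hp hp'
  have hrank : Module.rank k A ≤ Cardinal.aleph0 := by
    rw [← rank_top, ← hspan]
    exact (rank_span_le _).trans (Cardinal.mk_le_aleph0_iff.2 (Set.countable_range w).to_subtype)
  obtain ⟨χ⟩ := exists_algHom_of_rank_le (k := k) A hrank
  let y : R →ₐ[k] k := (χ.comp (IsScalarTower.toAlgHom k (R ⧸ I) A)).comp q
  refine ⟨y, fun a ha => ?_, fun t ht => ?_⟩
  · have : q a = 0 := Ideal.Quotient.eq_zero_iff_mem.2 ha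
    simp [y, this]
  · have h1 : IsUnit (algebraMap (R ⧸ I) A (q t)) :=
      IsLocalization.map_units A (⟨q t, t, Submonoid.subset_closure ht, rfl⟩ : S)
    exact (h1.map χ).ne_zero

end Uncountable

/-! ### Statement 4: closures of locally closed sets -/

section LocallyClosed

variable {k : Type u} [Field k] [IsAlgClosed k] [Uncountable k]

/-- If a locally closed subset of a variety over an uncountable field is covered by countably many
closed subsets, so is its closure. -/
theorem Variety.closure_subset_iUnion {A : Variety k} {B : Set A.Point} (hB : IsLocallyClosed B)
    {C : ℕ → Set A.Point} (hC : ∀ d, IsClosed (C d)) (hBC : B ⊆ ⋃ d, C d) :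
    closure B ⊆ ⋃ d, C d := by
  intro x hx
  by_contra hxC
  rw [Set.mem_iUnion, not_exists] at hxC
  obtain ⟨R, _, _, _, pt, ⟨y₀, rfl⟩, hclosed, hopen⟩ := A.exists_chart x
  have hnoeth : IsNoetherianRing R := Algebra.FiniteType.isNoetherianRing k R
  -- Supposing x outside every C d, separate it from each by one function; a point of B where no u d
  -- vanishes will be the contradiction.
  have hu : ∀ d, ∃ u, y₀ u ≠ 0 ∧ ∀ y, pt y ∈ C d → y u = 0 := fun d => by
    obtain ⟨J, hJ⟩ := hclosed _ (hC d)
    have h := hxC d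
    rw [hJ] at h
    push Not at h
    obtain ⟨u, huJ, hu⟩ := h
    exact ⟨u, hu, fun y hy => (hJ y).1 hy u huJ⟩
  choose u hu hu' using hu
  obtain ⟨U, W, hU, hW, rfl⟩ := hB
  obtain ⟨I, hI⟩ := hclosed W hW
  obtain ⟨J, hJ⟩ := hclosed Uᶜ hU.isClosed_compl
  obtain ⟨S, hS⟩ := (isNoetherianRing_iff_ideal_fg R).1 hnoeth J
  have hJS : ∀ y : R →ₐ[k] k, pt y ∈ U ↔ ∃ s ∈ S, y s ≠ 0 := fun y => by
    rw [← not_iff_not, ← Set.mem_compl_iff, hJ]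
    push Not
    constructor
    · exact fun h s hs => h s (by rw [← hS]; exact Ideal.subset_span hs)
    · intro h
      have : J ≤ RingHom.ker y := by
        rw [← hS]
        exact Ideal.span_le.2 fun s hs => h s hs
      exact fun s hs => this hs
  -- U is a finite union of principal opens in the chart, so one of them, cut with W, still
  -- accumulates at x: otherwise the product of the bad neighbourhoods would miss B.
  have hs : ∃ s ∈ S, ∀ b, y₀ b ≠ 0 → ∃ y : R →ₐ[k] k, (∀ a ∈ I, y a = 0) ∧ y s ≠ 0 ∧ y b ≠ 0 := by
    by_contra! h
    choose! b hb hb' using h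
    have hprod : y₀ (∏ s ∈ S, b s) ≠ 0 := by
      rw [map_prod]
      exact Finset.prod_ne_zero_iff.2 hb
    obtain ⟨_, ⟨y, hy, rfl⟩, hyU, hyW⟩ := mem_closure_iff.1 hx _ (hopen (∏ s ∈ S, b s))
      ⟨y₀, hprod, rfl⟩
    obtain ⟨s, hs, hys⟩ := (hJS y).1 hyU
    rw [Set.mem_ofPred_eq, map_prod, Finset.prod_ne_zero_iff] at hy
    exact hy s hs (hb' s hs y ((hI y).1 hyW) hys)
  obtain ⟨s, hsS, hs⟩ := hs
  obtain ⟨y, hyI, hyT⟩ := exists_algHom_ne_zero (k := k) I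
    (T := {s} ∪ Set.range u) ((Set.countable_singleton s).union (Set.countable_range u)) (by
      intro t ht htI
      rw [Submonoid.closure_union] at ht
      obtain ⟨a, ha, b, hb, rfl⟩ := Submonoid.mem_sup.1 ht
      obtain ⟨m, rfl⟩ := Submonoid.mem_closure_singleton.1 ha
      have hb0 : y₀ b ≠ 0 := by
        refine Submonoid.closure_induction (fun x hx => ?_) ?_ (fun x y _ _ hx hy => ?_) hb
        · obtain ⟨d, rfl⟩ := hx
          exact hu d
        · simp
        · rw [map_mul]; exact mul_ne_zero hx hy
      obtain ⟨y, hyI, hys, hyb⟩ := hs b hb0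
      have := hyI _ htI
      rw [map_mul, map_pow] at this
      exact mul_ne_zero (pow_ne_zero _ hys) hyb this)
  have hyB : pt y ∈ U ∩ W :=
    ⟨(hJS y).2 ⟨s, hsS, hyT s (Or.inl rfl)⟩, (hI y).2 hyI⟩
  obtain ⟨d, hd⟩ := Set.mem_iUnion.1 (hBC hyB)
  exact hyT (u d) (Or.inr ⟨d, rfl⟩) (hu' d y hd)

theorem IsDynamicallyRegular.closure_subset_conjClass {n : ℕ} {f : SAut n k}
    (hf : IsDynamicallyRegular (f : PAut n k)) (A : Variety k) (F : SAut n A.functions)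
    {B : Set A.Point} (hB : IsLocallyClosed B)
    (hBF : B ⊆ SAut.fiber F ⁻¹' SAut.conjClass f) :
    closure B ⊆ SAut.fiber F ⁻¹' SAut.conjClass f := by
  have hunion : SAut.fiber F ⁻¹' SAut.conjClass f = ⋃ d : ℕ, {x : A.Point |
      ∃ g : SAut n k, (SAut.toEnd g).degree ≤ d ∧
        PolyEnd.map x.ev (SAut.toEnd F) = SAut.toEnd (g * f * g⁻¹)} := by
    ext x
    rw [Set.mem_iUnion]
    constructor
    · rintro ⟨g, hg⟩
      exact ⟨_, g, le_rfl, congrArg SAut.toEnd hg⟩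
    · rintro ⟨d, g, -, hg⟩
      exact ⟨g, SAut.toEnd_injective hg⟩
  rw [hunion] at hBF ⊢
  exact Variety.closure_subset_iUnion hB (fun d => hf.isClosed_setOf_conj d _) hBF

end LocallyClosed

end PolyAut

namespace PolyAut
open MvPolynomial IsLocalRing

noncomputable section

/-! ### Top forms and degrees of composites -/

section TopAt

variable {n : ℕ} {k : Type u} [Field k]

/-- The map given by the components of top degree. -/
def PolyEnd.topAt (a : PolyEnd n k) (r : Fin n → k) : Fin n → k :=
  fun i => eval r (homogeneousComponent a.degree (a.coord i))

theorem PolyEnd.topAt_smul (a : PolyEnd n k) (c : k) (r : Fin n → k) :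
    a.topAt (c • r) = c ^ a.degree • a.topAt r :=
  funext fun i => eval₂_mul_of_isHomogeneous (RingHom.id k) c r
    (homogeneousComponent_isHomogeneous a.degree (a.coord i))

theorem homogeneousComponent_totalDegree_ne_zero {p : MvPolynomial (Fin n) k} (hp : p ≠ 0) :
    homogeneousComponent p.totalDegree p ≠ 0 := by
  obtain ⟨m, hm, h⟩ := Finset.exists_mem_eq_sup p.support
    (Finset.nonempty_iff_ne_empty.2 (by simpa using hp)) fun s => s.sum fun _ e => e
  intro h0
  have h1 := congrArg (coeff m) h0
  rw [coeff_homogeneousComponent, if_pos (show m.degree = p.totalDegree from h.symm),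
    coeff_zero] at h1
  exact mem_support_iff.1 hm h1

theorem PolyEnd.exists_topAt_ne_zero [Infinite k] {a : PolyEnd n k} (ha : 0 < a.degree) :
    ∃ r, a.topAt r ≠ 0 := by
  by_contra! h
  have hn : (Finset.univ : Finset (Fin n)).Nonempty := by
    rw [Finset.nonempty_iff_ne_empty]
    intro he
    rw [PolyEnd.degree, he] at ha
    simp at ha
  obtain ⟨i, -, hi⟩ := Finset.exists_mem_eq_sup _ hn fun i => (a.coord i).totalDegree
  change a.degree = _ at hi
  have h0 : a.coord i ≠ 0 := fun h0 => by rw [hi, h0, totalDegree_zero] at ha; omega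
  refine homogeneousComponent_totalDegree_ne_zero h0 (MvPolynomial.funext fun r => ?_)
  rw [← hi, map_zero]
  exact congrFun (h r) i

/-- Along the line T r, the coefficient of T^(deg a · deg b) in a ∘ b is the left side of `h`. -/
theorem PolyEnd.mul_degree_le {a b : PolyEnd n k} (hb : 0 < b.degree) {r : Fin n → k}
    (h : a.topAt (b.topAt r) ≠ 0) : a.degree * b.degree ≤ (a * b).degree := by
  obtain ⟨i, hi⟩ := Function.ne_iff.1 h
  let Q : Fin n → Polynomial k := fun l =>
    eval₂ Polynomial.C (fun j => Polynomial.C (r j) * Polynomial.X) (b.coord l)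
  have hline : ∀ (p : MvPolynomial (Fin n) k) (d : ℕ), p.totalDegree ≤ d →
      (eval₂ Polynomial.C (fun i => Polynomial.C (r i) * Polynomial.X) p).natDegree ≤ d :=
    fun p d hp => (natDegree_eval₂_le _ (fun i => natDegree_C_mul_X_le (r i)) hp).trans (mul_one d).le
  have hQ : ∀ l, (Q l).natDegree ≤ b.degree := fun l => hline _ _ (b.coord_totalDegree_le l)
  have h1 := coeff_eval₂_C Q hb hQ (a.coord_totalDegree_le i)
  have h2 : (fun l => (Q l).coeff b.degree) = b.topAt r := funext fun l =>
    coeff_eval₂_line r (b.coord_totalDegree_le l)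
  rw [h2] at h1
  have h3 : eval₂ Polynomial.C Q (a.coord i) =
      eval₂ Polynomial.C (fun j => Polynomial.C (r j) * Polynomial.X) ((a * b).coord i) :=
    (eval₂Hom_bind₁ Polynomial.C (fun j => Polynomial.C (r j) * Polynomial.X) b.coord
      (a.coord i)).symm
  refine le_trans ?_ (hline _ _ ((a * b).coord_totalDegree_le i))
  rw [← h3]
  refine Polynomial.le_natDegree_of_ne_zero ?_
  rw [h1]
  exact hi

theorem PolyEnd.degree_one_le : (1 : PolyEnd n k).degree ≤ 1 :=
  PolyEnd.degree_le_iff.2 fun i => (isHomogeneous_X k i).totalDegree_le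

theorem SAut.two_le_degree_inv {a : SAut n k} (ha : 2 ≤ (toEnd a).degree) :
    2 ≤ (toEnd a⁻¹).degree := by
  by_contra h
  have := degree_inv_le_one (a := a⁻¹) (by omega)
  rw [inv_inv] at this
  omega

/-- Otherwise the identity a ∘ a⁻¹ would have degree at least 4. -/
theorem SAut.topAt_topAt_inv {a : SAut n k} (ha : 2 ≤ (toEnd a).degree) (r : Fin n → k) :
    (toEnd a).topAt ((toEnd a⁻¹).topAt r) = 0 := by
  by_contra h
  have h2 := two_le_degree_inv ha
  have h1 := PolyEnd.mul_degree_le (by omega) h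
  rw [toEnd_mul_inv] at h1
  have h3 := h1.trans PolyEnd.degree_one_le
  have h4 := Nat.mul_le_mul ha h2
  omega

end TopAt

/-! ### Valuations of a plane curve centred at infinity -/

section Germ

variable {k : Type u} [Field k]

/-- A prime ideal contained in a proper ideal is the kernel of a map to a valuation ring whose
maximal ideal contains the image of the proper ideal. -/
theorem exists_valuationRing_of_prime {T : Type u} [CommRing T] {M Q : Ideal T} [Q.IsPrime]
    (hM : M ≠ ⊤) (hQM : Q ≤ M) :
    ∃ (L : Type u) (_ : Field L) (O : Type u) (_ : CommRing O) (_ : IsDomain O)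
      (_ : ValuationRing O) (_ : Algebra O L) (_ : IsFractionRing O L) (ρ : T →+* O),
      (∀ t, ρ t = 0 ↔ t ∈ Q) ∧ ∀ t ∈ M, ρ t ∈ maximalIdeal O := by
  let L := FractionRing (T ⧸ Q)
  let ρ : T →+* L := (algebraMap (T ⧸ Q) L).comp (Ideal.Quotient.mk Q)
  have hρ : ∀ t, ρ t = 0 ↔ t ∈ Q := fun t => by
    rw [← Ideal.Quotient.eq_zero_iff_mem]
    refine ⟨fun h => IsFractionRing.injective (T ⧸ Q) L (by rw [map_zero]; exact h), fun h => ?_⟩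
    rw [RingHom.comp_apply, h, map_zero]
  obtain ⟨O, _, _, _, _, _, ρ', hρ', hmax⟩ := exists_valuationSubring_dominating ρ hM
    (fun t ht => hQM ((hρ t).1 ht))
  refine ⟨L, inferInstance, O, inferInstance, inferInstance, inferInstance, inferInstance,
    inferInstance, ρ', fun t => ?_, hmax⟩
  rw [← hρ, ← hρ', RingHom.comp_apply, map_eq_zero_iff _ (IsFractionRing.injective O L)]

/-- A zero of a plane curve at infinity is the centre of a valuation of the curve. -/
theorem exists_point_at_infinity {d : ℕ} {p : MvPolynomial (Fin 2) k}
    {v w : Fin 2 → k} (hv : eval v (homogeneousComponent d p) = 0)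
    (hw : eval w (homogeneousComponent d p) ≠ 0) :
    ∃ (L : Type u) (_ : Field L) (O : Type u) (_ : CommRing O) (_ : IsDomain O)
      (_ : ValuationRing O) (_ : Algebra O L) (_ : IsFractionRing O L) (φ : k →+* O) (s : O)
      (x : Fin 2 → O), s ≠ 0 ∧ s ∈ maximalIdeal O ∧ homogVal φ d p s x = 0 ∧
        ∀ i, residue O (x i) = residue O (φ (v i)) := by
  let S : Polynomial (Polynomial k) := Polynomial.X
  let φ : k →+* Polynomial (Polynomial k) := Polynomial.C.comp Polynomial.C
  let z : Polynomial (Polynomial k) := Polynomial.C Polynomial.X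
  -- Local coordinates at the point at infinity v: z runs along the line at infinity towards w, and
  -- S = 0 is that line.
  let x : Fin 2 → Polynomial (Polynomial k) := fun i => φ (v i) + z * φ (w i)
  let P : Polynomial (Polynomial k) := homogVal φ d p S x
  let e : Polynomial (Polynomial k) →+* k := (Polynomial.evalRingHom 0).comp (Polynomial.evalRingHom 0)
  have heφ : e.comp φ = RingHom.id k := by ext c; simp [e, φ]
  have heS : e S = 0 := by simp [e, S]
  have hez : e z = 0 := by simp [e, z]
  have hP : P ∈ RingHom.ker e := by
    rw [RingHom.mem_ker, map_homogVal, heφ, heS, homogVal_zero]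
    have : (fun i => e (x i)) = v := funext fun i => by
      have h1 : ∀ c, e (φ c) = c := fun c => DFunLike.congr_fun heφ c
      simp only [x, map_add, map_mul, hez, h1, zero_mul, add_zero]
    rw [this]
    exact hv
  -- On S = 0, P is the top form of p at v + z w, whose z^d coefficient is the top form at w; so the
  -- line at infinity is not a component of the curve.
  have hSP : ¬ S ∣ P := by
    rintro ⟨P', hP'⟩
    have h1 := congrArg (Polynomial.evalRingHom 0) hP'
    have h2 : Polynomial.evalRingHom 0 S = 0 := by simp [S]
    have h3 : (Polynomial.evalRingHom (0 : Polynomial k)).comp φ = Polynomial.C := by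
      ext c; simp [φ]
    rw [map_mul, h2, zero_mul, map_homogVal, h2, h3, homogVal_zero] at h1
    have h4 : (fun i => Polynomial.evalRingHom 0 (x i)) =
        fun i => Polynomial.C (v i) + Polynomial.C (w i) * Polynomial.X := by
      funext i
      simp only [x, φ, z, map_add, map_mul, RingHom.comp_apply, Polynomial.coe_evalRingHom,
        Polynomial.eval_C]
      rw [mul_comm]
    rw [h4] at h1
    have h5 := coeff_eval₂_C (fun i => Polynomial.C (v i) + Polynomial.C (w i) * Polynomial.X)
      one_pos (fun i => Polynomial.natDegree_add_le_of_degree_le (by simp)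
        (natDegree_C_mul_X_le (w i)))
      (homogeneousComponent_isHomogeneous d p).totalDegree_le
    rw [h1, Polynomial.coeff_zero,
      homogeneousComponent_eq_self (homogeneousComponent_isHomogeneous d p)] at h5
    refine hw (Eq.trans ?_ h5.symm)
    congr 1
    congr 1
    funext i
    simp [Polynomial.coeff_C]
  have hP0 : P ≠ 0 := fun h => hSP (h ▸ dvd_zero S)
  -- An irreducible component of the curve through the centre, other than the line at infinity.
  obtain ⟨q, hqP, hqM, hqS, hq⟩ : ∃ q, q ∣ P ∧ q ∈ RingHom.ker e ∧ ¬ q ∣ S ∧ Prime q := by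
    have h1 := UniqueFactorizationMonoid.factors_prod hP0
    have h2 : (UniqueFactorizationMonoid.factors P).prod ∈ RingHom.ker e :=
      Ideal.mem_of_dvd _ h1.symm.dvd hP
    obtain ⟨q, hq, hqM⟩ :=
      ((RingHom.ker_isPrime e).multiset_prod_mem_iff_exists_mem _).1 h2
    have hqP : q ∣ P := (Multiset.dvd_prod hq).trans h1.dvd
    have hqp := UniqueFactorizationMonoid.prime_of_factor q hq
    refine ⟨q, hqP, hqM, fun h => hSP ?_, hqp⟩
    exact ((hqp.irreducible.associated_of_dvd Polynomial.irreducible_X h).symm.dvd).trans hqP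
  have hprime : (Ideal.span {q}).IsPrime := (Ideal.span_singleton_prime hq.ne_zero).2 hq
  obtain ⟨L, _, O, _, _, _, _, _, ρ', hρ'0, hmax⟩ := exists_valuationRing_of_prime
    (RingHom.ker_ne_top e) ((Ideal.span_singleton_le_iff_mem _).2 hqM)
  simp only [Ideal.mem_span_singleton] at hρ'0
  refine ⟨L, inferInstance, O, inferInstance, inferInstance, inferInstance, inferInstance,
    inferInstance, ρ'.comp φ, ρ' S, fun i => ρ' (x i), fun h => hqS ((hρ'0 _).1 h),
    hmax _ heS, ?_, fun i => ?_⟩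
  · rw [← map_homogVal, hρ'0]
    exact hqP
  · have h1 : residue O (ρ' z) = 0 := (residue_eq_zero_iff _).2 (hmax _ hez)
    simp only [x, map_add, map_mul, h1, zero_mul, add_zero, RingHom.comp_apply]

end Germ

/-! ### Statement 3: plane automorphisms -/

section Plane

variable {k : Type u} [Field k]

/-- The preimage under a of the line through 0 in direction r passes through v at infinity. Follow a
branch P there: a(P) = t r with t having a pole, so P = a⁻¹(t r) also tends to the direction of the
top form of a⁻¹ at r, when this is nonzero. Both limits agree. The assumption `hrw` keeps the top
form of the curve nonzero. -/
theorem SAut.topAt_inv_parallel_of_ne {a : SAut 2 k} (ha : 2 ≤ (toEnd a).degree)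
    {v : Fin 2 → k} (hv0 : v ≠ 0) (hv : (toEnd a).topAt v = 0) {r w : Fin 2 → k}
    (hrw : r 0 * (toEnd a).topAt w 1 ≠ r 1 * (toEnd a).topAt w 0) :
    v 0 * (toEnd a⁻¹).topAt r 1 = v 1 * (toEnd a⁻¹).topAt r 0 := by
  set d := (toEnd a).degree
  set e := (toEnd a⁻¹).degree
  have he : 2 ≤ e := two_le_degree_inv ha
  let p : MvPolynomial (Fin 2) k := C (r 0) * (toEnd a).coord 1 - C (r 1) * (toEnd a).coord 0
  have hpd : p.totalDegree ≤ d := by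
    refine (totalDegree_sub _ _).trans (max_le ?_ ?_) <;>
    · refine (totalDegree_mul _ _).trans ?_
      rw [totalDegree_C, zero_add]
      exact (toEnd a).coord_totalDegree_le _
  have hpe : ∀ y, eval y (homogeneousComponent d p) =
      r 0 * (toEnd a).topAt y 1 - r 1 * (toEnd a).topAt y 0 := fun y => by
    simp only [p, map_sub, homogeneousComponent_C_mul, map_mul, eval_C]
    rfl
  obtain ⟨L, _, O, _, _, _, _, _, φ, s, x, hs0, hsm, hhom, hx⟩ :=
    exists_point_at_infinity (v := v) (w := w) (by rw [hpe, hv]; simp)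
      (by rw [hpe]; exact sub_ne_zero.2 hrw)
  have hinj := IsFractionRing.injective O L
  let ι := algebraMap O L
  have hs0' : ι s ≠ 0 := fun h => hs0 (hinj (by rw [map_zero]; exact h))
  let φL := ι.comp φ
  let P : Fin 2 → L := fun i => ι (x i) / ι s
  have hsP : ∀ i, ι s * P i = ι (x i) := fun i => mul_div_cancel₀ _ hs0'
  let Q : Fin 2 → L := fun i => eval₂ φL P ((toEnd a).coord i)
  have hcurve : φL (r 0) * Q 1 = φL (r 1) * Q 0 := by
    have h1 := homogVal_mul φL hpd (ι s) P
    simp only [hsP] at h1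
    rw [show homogVal φL d p (ι s) (fun i => ι (x i)) = ι (homogVal φ d p s x) from
      (map_homogVal φ ι d p s x).symm, hhom, map_zero] at h1
    have h2 := (mul_eq_zero.1 h1.symm).resolve_left (pow_ne_zero _ hs0')
    rw [eval₂_sub, eval₂_mul, eval₂_mul, eval₂_C, eval₂_C, sub_eq_zero] at h2
    exact h2
  have hφ0 : ∀ c, φL c = 0 → c = 0 := fun c h => (map_eq_zero_iff φL φL.injective).1 h
  obtain ⟨t, ht⟩ : ∃ t, ∀ i, Q i = t * φL (r i) := by
    by_cases hr0 : r 0 = 0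
    · have hr1 : r 1 ≠ 0 := fun hr1 => hrw (by rw [hr0, hr1, zero_mul, zero_mul])
      have hr1' : φL (r 1) ≠ 0 := fun h => hr1 (hφ0 _ h)
      rw [hr0, map_zero, zero_mul] at hcurve
      refine ⟨Q 1 / φL (r 1), fun i => ?_⟩
      fin_cases i
      · simpa [hr0] using (mul_eq_zero.1 hcurve.symm).resolve_left hr1'
      · exact (div_mul_cancel₀ _ hr1').symm
    · have hr0' : φL (r 0) ≠ 0 := fun h => hr0 (hφ0 _ h)
      refine ⟨Q 0 / φL (r 0), fun i => ?_⟩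
      fin_cases i
      · exact (div_mul_cancel₀ _ hr0').symm
      · change Q 1 = Q 0 / φL (r 0) * φL (r 1)
        field_simp
        linear_combination hcurve
  have hPinv : ∀ i, P i = eval₂ φL (fun j => t * φL (r j)) ((toEnd a⁻¹).coord i) := fun i => by
    have h1 := eval₂Hom_bind₁ φL P (toEnd a).coord ((toEnd a⁻¹).coord i)
    have h2 := congrArg (fun b => b.coord i) (toEnd_inv_mul a)
    change bind₁ _ _ = X i at h2
    rw [h2] at h1
    simp only [coe_eval₂Hom, eval₂_X] at h1
    rw [h1]
    congr 1
    funext j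
    exact ht j
  have hnotint : ¬ ∀ i, ∃ y, ι y = P i := fun h => hv0 (funext fun i => by
    obtain ⟨y, hy⟩ := h i
    have h1 : x i = s * y := hinj (by rw [map_mul]; change ι (x i) = ι s * ι y; rw [hy, hsP])
    have h2 := hx i
    rw [h1, map_mul, (residue_eq_zero_iff s).2 hsm, zero_mul] at h2
    exact ((map_eq_zero_iff ((residue O).comp φ) (RingHom.injective _)).1 h2.symm))
  -- If t were integral, P = a⁻¹(t r) would be too, yet P leaves the affine plane because v ≠ 0.
  have htnot : ¬ ∃ y, ι y = t := by
    rintro ⟨y, hy⟩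
    refine hnotint fun i => ⟨eval₂ φ (fun j => y * φ (r j)) ((toEnd a⁻¹).coord i), ?_⟩
    rw [hPinv, eval₂_comp_left ι]
    congr 1
    funext j
    change ι (y * φ (r j)) = _
    rw [map_mul, hy]
    rfl
  have ht0 : t ≠ 0 := fun h => htnot ⟨0, by rw [h, map_zero]⟩
  obtain ⟨c, hc⟩ : ∃ c, ι c = t⁻¹ :=
    (ValuationRing.isInteger_or_isInteger O t).resolve_left htnot
  have hcm : c ∈ maximalIdeal O := by
    rw [mem_maximalIdeal, mem_nonunits_iff]
    rintro ⟨y, rfl⟩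
    refine htnot ⟨(y⁻¹ : Oˣ), ?_⟩
    rw [← inv_inv t, ← hc]
    refine eq_inv_of_mul_eq_one_left ?_
    rw [← map_mul, Units.inv_mul, map_one]
  -- With c = 1/t this is c^e a⁻¹(t r), a multiple of P as x is, but with reduction the top form of
  -- a⁻¹ at r.
  let y : Fin 2 → O := fun i => homogVal φ e ((toEnd a⁻¹).coord i) c fun j => φ (r j)
  have hy : ∀ i, c ^ e * x i = s * y i := fun i => hinj (by
    have h1 := homogVal_mul φL ((toEnd a⁻¹).coord_totalDegree_le i) (ι c)
      fun j => t * φL (r j)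
    have h2 : (fun j => ι c * (t * φL (r j))) = fun j => ι (φ (r j)) := funext fun j => by
      rw [hc, inv_mul_cancel_left₀ ht0]; rfl
    rw [h2, ← hPinv] at h1
    rw [map_mul, map_mul, map_pow]
    change ι c ^ e * ι (x i) = ι s * ι (homogVal φ e _ c _)
    rw [map_homogVal, h1, ← hsP]
    ring)
  have hpar : x 0 * y 1 = x 1 * y 0 := by
    refine mul_left_cancel₀ hs0 ?_
    linear_combination x 1 * hy 0 - x 0 * hy 1
  have hyres : ∀ i, residue O (y i) = (residue O).comp φ ((toEnd a⁻¹).topAt r i) := fun i => by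
    rw [map_homogVal, (residue_eq_zero_iff c).2 hcm, homogVal_zero]
    exact (eval₂_comp_left ((residue O).comp φ) (RingHom.id k) r _).symm
  have hfin := congrArg (residue O) hpar
  rw [map_mul, map_mul, hyres, hyres, hx, hx, ← RingHom.comp_apply, ← RingHom.comp_apply,
    ← map_mul, ← map_mul] at hfin
  exact RingHom.injective _ hfin

/-- The excluded r form one line, and a polynomial identity that holds off a line holds everywhere.
-/
theorem SAut.topAt_inv_parallel [Infinite k] {a : SAut 2 k} (ha : 2 ≤ (toEnd a).degree)
    {v : Fin 2 → k} (hv0 : v ≠ 0) (hv : (toEnd a).topAt v = 0) (r : Fin 2 → k) :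
    v 0 * (toEnd a⁻¹).topAt r 1 = v 1 * (toEnd a⁻¹).topAt r 0 := by
  obtain ⟨w, hw⟩ := PolyEnd.exists_topAt_ne_zero (a := toEnd a) (by omega)
  set W := (toEnd a).topAt w
  let top : Fin 2 → MvPolynomial (Fin 2) k := fun i =>
    homogeneousComponent (toEnd a⁻¹).degree ((toEnd a⁻¹).coord i)
  have key : (C (v 0) * top 1 - C (v 1) * top 0) * (C (W 1) * X 0 - C (W 0) * X 1) = 0 := by
    refine MvPolynomial.funext fun r => ?_
    simp only [map_mul, map_sub, eval_C, eval_X, map_zero]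
    by_cases h : r 0 * W 1 = r 1 * W 0
    · rw [show W 1 * r 0 - W 0 * r 1 = 0 by linear_combination h, mul_zero]
    · have := topAt_inv_parallel_of_ne ha hv0 hv h
      rw [show v 0 * eval r (top 1) - v 1 * eval r (top 0) = 0 from sub_eq_zero.2 this, zero_mul]
  have hne : (C (W 1) * X 0 - C (W 0) * X 1 : MvPolynomial (Fin 2) k) ≠ 0 := fun h => hw (by
    have h0 := congrArg (eval ![1, 0]) h
    have h1 := congrArg (eval ![0, 1]) h
    simp only [map_sub, map_mul, eval_C, eval_X, map_zero] at h0 h1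
    funext i
    fin_cases i
    · simpa using h1
    · simpa using h0)
  have := congrArg (eval r) ((mul_eq_zero.1 key).resolve_right hne)
  simp only [map_sub, map_mul, eval_C, map_zero, sub_eq_zero] at this
  exact this

theorem exists_smul_of_parallel {v w : Fin 2 → k} (hv : v ≠ 0) (h : v 0 * w 1 = v 1 * w 0) :
    ∃ c : k, w = c • v := by
  by_cases h0 : v 0 = 0
  · have h1 : v 1 ≠ 0 := fun h1 => hv (by funext i; fin_cases i <;> simp [h0, h1])
    refine ⟨w 1 / v 1, ?_⟩
    rw [h0, zero_mul] at h
    funext i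
    fin_cases i
    · simpa [h0] using (mul_eq_zero.1 h.symm).resolve_left h1
    · simp [h1]
  · refine ⟨w 0 / v 0, ?_⟩
    funext i
    fin_cases i
    · simp [h0]
    · change w 1 = w 0 / v 0 * v 1
      field_simp
      linear_combination h

/-- The line at infinity is contracted by `a` onto the point of indeterminacy of the inverse. -/
theorem SAut.exists_direction [Infinite k] {a : SAut 2 k} (ha : 2 ≤ (toEnd a).degree) :
    ∃ v : Fin 2 → k, v ≠ 0 ∧ (∀ r, ∃ c : k, (toEnd a).topAt r = c • v) ∧
      ∀ w, (toEnd a⁻¹).topAt w = 0 → ∃ c : k, w = c • v := by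
  obtain ⟨r₀, hr₀⟩ := PolyEnd.exists_topAt_ne_zero (a := toEnd a) (by omega)
  have ha' := two_le_degree_inv ha
  have hT : ∀ w, w ≠ 0 → (toEnd a⁻¹).topAt w = 0 → ∀ r,
      w 0 * (toEnd a).topAt r 1 = w 1 * (toEnd a).topAt r 0 := fun w hw0 hw r => by
    have := topAt_inv_parallel ha' hw0 hw r
    rwa [inv_inv] at this
  have h0 : (toEnd a⁻¹).topAt ((toEnd a).topAt r₀) = 0 := by
    have := topAt_topAt_inv ha' r₀
    rwa [inv_inv] at this
  refine ⟨_, hr₀, fun r => exists_smul_of_parallel hr₀ (hT _ hr₀ h0 r), fun w hw => ?_⟩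
  by_cases hw0 : w = 0
  · exact ⟨0, by rw [hw0, zero_smul]⟩
  · refine exists_smul_of_parallel hr₀ ?_
    linear_combination -hT w hw0 hw r₀

theorem SAut.mul_degree_le_of_direction [Infinite k] {n : ℕ} {a b : SAut n k}
    (hb : 2 ≤ (toEnd b).degree) {v : Fin n → k}
    (hv : ∀ r, ∃ c : k, (toEnd b).topAt r = c • v) (h : (toEnd a).topAt v ≠ 0) :
    (toEnd a).degree * (toEnd b).degree ≤ (toEnd (a * b)).degree := by
  obtain ⟨r, hr⟩ := PolyEnd.exists_topAt_ne_zero (a := toEnd b) (by omega)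
  obtain ⟨c, hc⟩ := hv r
  have hc0 : c ≠ 0 := by
    rintro rfl
    exact hr (by rw [hc, zero_smul])
  refine PolyEnd.mul_degree_le (by omega) (r := r) ?_
  rw [hc, PolyEnd.topAt_smul]
  exact smul_ne_zero (pow_ne_zero _ hc0) h

/-- Replacing g by g f^(-m) does not change the conjugate, so b = f^m g⁻¹ may be taken of least
degree. Unless the contracted directions of f b, b and f⁻¹ b all coincide, degrees multiply in a
factorization of b⁻¹ f b, which bounds a conjugator. If they coincide, regularity of f contradicts
minimality. -/
theorem IsDynamicallyRegular.exists_conj_degree_le [Infinite k] {f : SAut 2 k}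
    (hf : IsDynamicallyRegular (f : PAut 2 k)) (g : SAut 2 k) :
    ∃ g' : SAut 2 k, (SAut.toEnd g').degree ≤ (SAut.toEnd (g * f * g⁻¹)).degree + 1 ∧
      g * f * g⁻¹ = g' * f * g'⁻¹ := by
  obtain ⟨m, hm⟩ : ∃ m : ℤ, ∀ m' : ℤ, (SAut.toEnd (f ^ m * g⁻¹)).degree ≤
      (SAut.toEnd (f ^ m' * g⁻¹)).degree :=
    ⟨Function.argmin fun m : ℤ => (SAut.toEnd (f ^ m * g⁻¹)).degree, fun m' =>
      Function.argmin_le (f := fun m : ℤ => (SAut.toEnd (f ^ m * g⁻¹)).degree) m'⟩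
  set b := f ^ m * g⁻¹
  have hconj : g * f * g⁻¹ = b⁻¹ * f * b := by simp only [b]; group
  have h1 : (SAut.toEnd b).degree ≤ (SAut.toEnd (f * b)).degree := by
    have := hm (1 + m)
    rwa [zpow_add, zpow_one, mul_assoc] at this
  have h2 : (SAut.toEnd b).degree ≤ (SAut.toEnd (f⁻¹ * b)).degree := by
    have := hm (-1 + m)
    rwa [zpow_add, zpow_neg_one, mul_assoc] at this
  clear_value b
  rw [hconj]
  rcases Nat.lt_or_ge (SAut.toEnd b).degree 2 with hb | hb
  -- The summand 1 in the bound absorbs this affine case.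
  · exact ⟨b⁻¹, (SAut.degree_inv_le_one (by omega)).trans (by omega), by rw [inv_inv]⟩
  obtain ⟨v, hv0, hvtop, hv⟩ := SAut.exists_direction hb
  obtain ⟨v₁, hv₁0, hv₁top, hv₁⟩ := SAut.exists_direction (hb.trans h1)
  obtain ⟨v₂, hv₂0, hv₂top, hv₂⟩ := SAut.exists_direction (hb.trans h2)
  -- If nonzero, degrees multiply in b⁻¹ · (f b), which bounds deg b⁻¹.
  by_cases hA : (SAut.toEnd b⁻¹).topAt v₁ = 0
  swap
  · have := SAut.mul_degree_le_of_direction (hb.trans h1) hv₁top hA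
    rw [← mul_assoc] at this
    refine ⟨b⁻¹, ?_, by rw [inv_inv]⟩
    have := (Nat.le_mul_of_pos_right (SAut.toEnd b⁻¹).degree
      (show 0 < (SAut.toEnd (f * b)).degree by omega)).trans this
    omega
  -- If nonzero, degrees multiply in (b⁻¹ f) · b, and b⁻¹ f is a conjugator as well.
  by_cases hB : (SAut.toEnd (f⁻¹ * b)⁻¹).topAt v = 0
  swap
  · have := SAut.mul_degree_le_of_direction hb hvtop hB
    rw [show (f⁻¹ * b)⁻¹ * b = b⁻¹ * f * b by group] at this
    refine ⟨(f⁻¹ * b)⁻¹, ?_, by group⟩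
    have := (Nat.le_mul_of_pos_right (SAut.toEnd (f⁻¹ * b)⁻¹).degree
      (show 0 < (SAut.toEnd b).degree by omega)).trans this
    omega
  exfalso
  obtain ⟨c₁, rfl⟩ := hv _ hA
  obtain ⟨c₂, rfl⟩ := hv₂ _ hB
  have hc₁ : c₁ ≠ 0 := by
    rintro rfl
    exact hv₁0 (zero_smul _ _)
  -- The common direction is not a zero of both top forms, so degrees multiply in f⁻¹ · (f b) or in
  -- f · (f⁻¹ b); either makes deg b at least twice the degree of f b or of f⁻¹ b.
  by_cases hf1 : (SAut.toEnd f).topAt (c₂ • v₂) = 0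
  · have hf2 : (SAut.toEnd f⁻¹).topAt (c₂ • v₂) ≠ 0 := fun hf2 =>
      hv0 (hf.eq_zero (congrFun hf1) (congrFun hf2))
    have := SAut.mul_degree_le_of_direction (a := f⁻¹) (hb.trans h1) hv₁top (by
      rw [PolyEnd.topAt_smul]
      exact smul_ne_zero (pow_ne_zero _ hc₁) hf2)
    rw [inv_mul_cancel_left] at this
    have h3 := Nat.mul_le_mul_right (SAut.toEnd (f * b)).degree hf.two_le_degree_inv
    omega
  · have := SAut.mul_degree_le_of_direction (a := f) (hb.trans h2) hv₂top (fun h => hf1 (by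
      rw [PolyEnd.topAt_smul, h, smul_zero]))
    rw [mul_inv_cancel_left] at this
    have h3 := Nat.mul_le_mul_right (SAut.toEnd (f⁻¹ * b)).degree hf.1
    change 2 * _ ≤ (SAut.toEnd f).degree * _ at h3
    omega

theorem IsDynamicallyRegular.isClosed_conjClass [IsAlgClosed k] {f : SAut 2 k}
    (hf : IsDynamicallyRegular (f : PAut 2 k)) : IsClosed (SAut.conjClass f) := by
  have : Infinite k := IsAlgClosed.instInfinite
  refine SAut.isClosed_of_forall fun A F => ?_
  -- Every fibre of F has degree at most deg F, so one bound on the conjugators serves the whole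
  -- family.
  convert! hf.isClosed_setOf_conj (F.degree + 1) F using 1
  ext x
  constructor
  · rintro ⟨_, ⟨g, rfl⟩, hx⟩
    obtain ⟨g', hg', hgg'⟩ := hf.exists_conj_degree_le g
    refine ⟨g', hg'.trans ?_, hgg' ▸ hx⟩
    rw [← hx]
    exact Nat.add_le_add_right (PolyEnd.degree_map_le _ _) 1
  · rintro ⟨g, -, hx⟩
    exact ⟨_, ⟨g, rfl⟩, hx⟩

end Plane

end

end PolyAut

theorem theorem1 {k : Type u} [Field k] [IsAlgClosed k] {n : ℕ}
    (f : SAut n k) (hf : IsDynamicallyRegular (f : PAut n k)) :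
    -- (1)
    (∀ α : SAut n (LaurentSeries k),
      HasValue (SAut.toEnd (α * toLaurent f * α⁻¹)) →
        HasValue (SAut.toEnd α) ∧
        ∃ a : SAut n k, SAut.toEnd a = value (SAut.toEnd α) ∧
          value (SAut.toEnd (α * toLaurent f * α⁻¹)) = SAut.toEnd (a * f * a⁻¹)) ∧
    -- (2)
    (∀ d : ℕ, IsClosed {h : SAut n k |
      ∃ g : SAut n k, (SAut.toEnd g).degree ≤ d ∧ h = g * f * g⁻¹}) ∧
    -- (3)
    (n = 2 → IsClosed (SAut.conjClass f)) ∧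
    -- (4)
    (Uncountable k → ∀ (A : Variety k) (F : SAut n A.functions) (B : Set A.Point),
      IsLocallyClosed B →
        B ⊆ SAut.fiber F ⁻¹' SAut.conjClass f →
          closure B ⊆ SAut.fiber F ⁻¹' SAut.conjClass f) := by
  refine ⟨hf.hasValue_conj, hf.isClosed_conj_degree_le, ?_, ?_⟩
  · rintro rfl
    exact hf.isClosed_conjClass
  · intro _ A F B hB hBF
    exact hf.closure_subset_conjClass A F hB hBF
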